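/- For real $a,b$ let $U(a,b,z)$ denote the confluent hypergeometric function of the second kind (Tricomi's function) on its principal branch $|\arg z|<\pi$: for $b\notin\mathbb Z$, $$U(a,b,z)=\frac{\Gamma(1-b)}{\Gamma(a-b+1)}M(a,b,z)+\frac{\Gamma(b-1)}{\Gamma(a)}z^{1-b}M(a-b+1,2-b,z),\qquad M(a,b,z)=\sum_{r=0}^\infty\frac{(a)_r}{(b)_r}\frac{z^r}{r!},$$ where $(a)_r$ is the rising factorial, $1/\Gamma$ is taken to be $0$ at the poles of $\Gamma$ and $z^{1-b}$ is the principal power; for $b\in\mathbb Z$, $U(a,b,z)=\lim_{\beta\to b,\ \beta\in\mathbb R\setminus\mathbb Z}U(a,\beta,z)$. Then $U(a,b,\cdot)$ is analytic in the cut plane $\mathbb C\setminus(-\infty,0]$ for the parameters considered below, and the number $\#U$ of its zeros there, counted according to multiplicity, is as follows. (i) If $-2m-1\le a<-2m+1$ for some integer $m\ge 0$, and $b<a+1$, then $\#U=2m$. (ii) If $a=b\ge 1$, then $\#U=0$. -/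

import Mathlib

open Filter Topology

/-- Kummer's function `M(a,b,z) = ∑ (a)_r / (b)_r * z^r / r!` (also written `₁F₁(a;b;z)`), for real
parameters `a`, `b` with `b` not in `{0,-1,-2,…}` and complex `z`; `(a)_r` is the rising factorial. -/
noncomputable def kummerM (a b : ℝ) (z : ℂ) : ℂ :=
  ∑' r : ℕ, (((ascPochhammer ℝ r).eval a / (ascPochhammer ℝ r).eval b : ℝ) : ℂ) *
    (z ^ r / (r.factorial : ℂ))

/-- The formula
`Γ(1-b)/Γ(a-b+1) M(a,b,z) + Γ(b-1)/Γ(a) z^(1-b) M(a-b+1,2-b,z)` for `U(a,b,z)`, `b ∉ ℤ`.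
The power is the principal one. At the poles of `Γ` the library's `Γ` is `0`, so that a quotient
by it is `0`, in accordance with the convention that `1/Γ` is entire and vanishes there. -/
noncomputable def tricomiFormula (a b : ℝ) (z : ℂ) : ℂ :=
  ((Real.Gamma (1 - b) / Real.Gamma (a - b + 1) : ℝ) : ℂ) * kummerM a b z +
    ((Real.Gamma (b - 1) / Real.Gamma a : ℝ) : ℂ) * z ^ ((1 - b : ℝ) : ℂ) *
      kummerM (a - b + 1) (2 - b) z

open Classical in
/-- The confluent hypergeometric function of the second kind (Tricomi's function) `U(a,b,z)`,
for real `a`, `b`, on its principal branch `|arg z| < π`. For integer `b` it is the limit of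
`U(a,β,z)` as `β → b`. -/
noncomputable def tricomiU (a b : ℝ) (z : ℂ) : ℂ :=
  if ∃ n : ℤ, (n : ℝ) = b then limUnder (𝓝[≠] b) (fun β : ℝ => tricomiFormula a β z)
  else tricomiFormula a b z

/-- `f` is analytic at every point of `S`, it has only finitely many zeros in `S`, and their number,
counted according to multiplicity, is `N`. -/
def HasZeroCount (f : ℂ → ℂ) (S : Set ℂ) (N : ℕ) : Prop :=
  AnalyticOnNhd ℂ f S ∧ {z | z ∈ S ∧ f z = 0}.Finite ∧
    ∑ᶠ z ∈ {z | z ∈ S ∧ f z = 0}, analyticOrderNatAt f z = N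

/-! The function is an average of powers. If `b < 1` and `c = a - b + 1 > 0`, then `U(a,b,z)` is the
expectation of `(z + S)^(-a)`, where `S` is Gamma distributed with shape `c`
(`tricomiU_eq_gammaMoment`). If `b ≥ 1` and `a > 0`, Kummer's transformation gives the factor
`z^(1-b)` times such an expectation (`tricomiU_eq_cpow_mul_gammaMoment`). So only the zeros of a
moment with exponent `p` have to be counted.

The representation is proved for `0 < b < 1` by uniqueness for a first-order linear system solved by
each function together with its neighbour at `b - 1`: the Wronskians of the difference with two
basis solutions vanish at the origin. Contiguous relations carry it to smaller `b`, and continuity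
in the parameters to integer `b`.

For `|p| ≤ 1` the imaginary part of `(z + s)^p` has a constant sign in the upper half-plane, so
there are no zeros (`gammaMoment_ne_zero`). For `p > 0` and `|p - 2m| < 1` the moment extends
continuously to the closed upper half-plane, behaves like `z^p` at infinity, and on the real axis
equals `A e^(iπ(p-2m)) + B` with `A ≥ 0` and `B > 0`, which avoids `(-∞, 0]`. Zeros come in
conjugate pairs, `2k` in all. Dividing them out leaves a zero-free function of growth `z^(p-2k)`;
its argument changes by about `(p-2k)π` over a large half circle and by less than about `π` on the
real axis. Hence `|2m - 2k| < 2` and `k = m` (`hasZeroCount_of_tendsto`). The endpoint `p = 2m + 1`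
gives a polynomial, increasing on the real line; its one real zero lies on the cut, and after
division by it the same argument applies. -/

open MeasureTheory Set

/-! ### Moments of the Gamma distribution: convergence and analyticity in the cut plane -/

/-- The density of the standard Gamma distribution with shape `c` on the positive half-line. -/
noncomputable def gammaDensity (c s : ℝ) : ℝ :=
  Real.exp (-s) * s ^ (c - 1) / Real.Gamma c

/-- The moment `∫ (z + s)^p` against the Gamma distribution with shape `c`. -/
noncomputable def gammaMoment (p c : ℝ) (z : ℂ) : ℂ :=
  ∫ s in Ioi (0 : ℝ), (gammaDensity c s : ℂ) * (z + s) ^ (p : ℂ)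

theorem gammaDensity_pos {c s : ℝ} (hc : 0 < c) (hs : 0 < s) : 0 < gammaDensity c s := by
  have := Real.Gamma_pos_of_pos hc
  unfold gammaDensity
  positivity

theorem measurable_gammaDensity (c : ℝ) : Measurable (gammaDensity c) := by
  unfold gammaDensity
  fun_prop

theorem measurable_gammaMoment_integrand (p c : ℝ) (z : ℂ) :
    Measurable fun s : ℝ => (gammaDensity c s : ℂ) * (z + s) ^ (p : ℂ) := by
  have := measurable_gammaDensity c
  fun_prop

theorem gammaDensity_mul_rpow {c k s : ℝ} (hs : 0 < s) :
    gammaDensity c s * s ^ k = Real.exp (-s) * s ^ (c + k - 1) / Real.Gamma c := by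
  unfold gammaDensity
  rw [show c + k - 1 = (c - 1) + k by ring, Real.rpow_add hs]
  ring

theorem integrableOn_gammaDensity_mul_rpow {c k : ℝ} (h : 0 < c + k) :
    IntegrableOn (fun s => gammaDensity c s * s ^ k) (Ioi 0) :=
  IntegrableOn.congr_fun ((Real.GammaIntegral_convergent h).div_const (Real.Gamma c))
    (fun _ hs => (gammaDensity_mul_rpow hs).symm) measurableSet_Ioi

theorem integral_gammaDensity_mul_rpow {c k : ℝ} (h : 0 < c + k) :
    ∫ s in Ioi (0 : ℝ), gammaDensity c s * s ^ k = Real.Gamma (c + k) / Real.Gamma c := by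
  rw [Real.Gamma_eq_integral h, ← integral_div]
  exact setIntegral_congr_fun measurableSet_Ioi fun _ hs => gammaDensity_mul_rpow hs

theorem integrableOn_gammaDensity {c : ℝ} (hc : 0 < c) :
    IntegrableOn (gammaDensity c) (Ioi 0) := by
  simpa using integrableOn_gammaDensity_mul_rpow (c := c) (k := 0) (by simpa)

theorem integral_gammaDensity {c : ℝ} (hc : 0 < c) :
    ∫ s in Ioi (0 : ℝ), gammaDensity c s = 1 := by
  have := integral_gammaDensity_mul_rpow (c := c) (k := 0) (by simpa)
  simpa [(Real.Gamma_pos_of_pos hc).ne'] using this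

theorem integrableOn_gammaDensity_mul_one_add {c A : ℝ} (hc : 0 < c) (hA : 0 ≤ A) :
    IntegrableOn (fun s => gammaDensity c s * (1 + s ^ A)) (Ioi 0) := by
  simp_rw [mul_add, mul_one]
  exact (integrableOn_gammaDensity hc).add (integrableOn_gammaDensity_mul_rpow (by linarith))

theorem one_add_rpow_le {s A : ℝ} (hs : 0 < s) (hA : 0 ≤ A) :
    (1 + s) ^ A ≤ 2 ^ A * (1 + s ^ A) := by
  have h1 : 0 < s ^ A := Real.rpow_pos_of_pos hs A
  rcases le_total s 1 with h | h
  · calc (1 + s) ^ A ≤ 2 ^ A := Real.rpow_le_rpow (by linarith) (by linarith) hA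
      _ ≤ 2 ^ A * (1 + s ^ A) := le_mul_of_one_le_right (by positivity) (by linarith)
  · calc (1 + s) ^ A ≤ (2 * s) ^ A := Real.rpow_le_rpow (by linarith) (by linarith) hA
      _ = 2 ^ A * s ^ A := Real.mul_rpow (by norm_num) hs.le
      _ ≤ 2 ^ A * (1 + s ^ A) := by gcongr; linarith

/-- The lower bound on `x` controls negative exponents and the upper bound positive ones. One
constant for all `|r| ≤ A` is what allows the exponent to vary in `tendsto_gammaMoment_param`. -/
theorem rpow_le_of_abs_le {x l u r A : ℝ} (hl : 0 < l) (hl1 : l ≤ 1) (hx : l ≤ x) (hu : x ≤ u)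
    (hu1 : 1 ≤ u) (hr : |r| ≤ A) : x ^ r ≤ l ^ (-A) * u ^ A := by
  have hA : 0 ≤ A := (abs_nonneg r).trans hr
  have hx0 : 0 < x := hl.trans_le hx
  obtain ⟨h1, h2⟩ := abs_le.1 hr
  have hlA : 1 ≤ l ^ (-A) := Real.one_le_rpow_of_pos_of_le_one_of_nonpos hl hl1 (by linarith)
  have huA : 1 ≤ u ^ A := Real.one_le_rpow hu1 hA
  rcases le_total x 1 with h | h
  · calc x ^ r ≤ x ^ (-A) := Real.rpow_le_rpow_of_exponent_ge hx0 h h1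
      _ ≤ l ^ (-A) := Real.rpow_le_rpow_of_nonpos hl hx (by linarith)
      _ ≤ _ := le_mul_of_one_le_right (by positivity) huA
  · calc x ^ r ≤ x ^ A := Real.rpow_le_rpow_of_exponent_le h h2
      _ ≤ u ^ A := Real.rpow_le_rpow hx0.le hu hA
      _ ≤ _ := le_mul_of_one_le_left (by positivity) hlA

theorem add_ofReal_mem_slitPlane {z : ℂ} (hz : z ∈ Complex.slitPlane) {s : ℝ} (hs : 0 ≤ s) :
    z + s ∈ Complex.slitPlane := by
  rcases hz with h | h
  · left; simp; linarith
  · right; simpa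

/-- Locally uniform bound for powers of `z + s`. -/
theorem exists_norm_add_cpow_le {z₀ : ℂ} (hz₀ : z₀ ∈ Complex.slitPlane) {A : ℝ} (hA : 0 ≤ A) :
    ∃ D : ℝ, 0 < D ∧ ∃ ρ > 0, Metric.ball z₀ ρ ⊆ Complex.slitPlane ∧ ∀ z ∈ Metric.ball z₀ ρ,
      ∀ s : ℝ, 0 < s → ∀ r : ℝ, |r| ≤ A → ‖(z + s) ^ (r : ℂ)‖ ≤ D * (1 + s ^ A) := by
  obtain ⟨ρ, hρ, hball⟩ := Metric.isOpen_iff.1 Complex.isOpen_slitPlane z₀ hz₀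
  set l := min (ρ / 2) 1 with hl
  have hl0 : 0 < l := lt_min (by linarith) one_pos
  set C := ‖z₀‖ + l + 1 with hC
  have hC1 : 1 ≤ C := by have := norm_nonneg z₀; linarith
  refine ⟨l ^ (-A) * (C ^ A * 2 ^ A), by positivity, l, hl0, fun z hz => hball ?_, ?_⟩
  · refine Metric.ball_subset_ball ?_ hz
    exact (min_le_left _ _).trans (by linarith)
  intro z hz s hs r hr
  have hz' : ‖z - z₀‖ < l := by simpa [dist_eq_norm] using hz
  -- The point `-s` lies on the cut, hence at distance at least `ρ` from `z₀`; moving from `z₀` to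
  -- `z` costs less than `l ≤ ρ / 2`.
  have hlow : l ≤ ‖z + s‖ := by
    have h1 : ρ ≤ ‖z₀ + s‖ := by
      by_contra! hlt
      have : (-(s : ℂ)) ∈ Complex.slitPlane := hball (by
        rwa [Metric.mem_ball, dist_eq_norm, ← norm_neg, neg_sub, sub_neg_eq_add])
      rw [← Complex.ofReal_neg, Complex.ofReal_mem_slitPlane] at this
      linarith
    have h2 : ‖z₀ + s‖ ≤ ‖z + s‖ + ‖z - z₀‖ := by
      calc ‖z₀ + s‖ = ‖(z + s) - (z - z₀)‖ := by congr 1; ring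
        _ ≤ _ := norm_sub_le _ _
    have h3 : l ≤ ρ / 2 := min_le_left _ _
    linarith
  have hup : ‖z + s‖ ≤ C * (1 + s) := by
    have h1 : ‖z + s‖ ≤ ‖z₀‖ + ‖z - z₀‖ + s := by
      calc ‖z + s‖ = ‖z₀ + (z - z₀) + s‖ := by congr 1; ring
        _ ≤ ‖z₀ + (z - z₀)‖ + ‖(s : ℂ)‖ := norm_add_le _ _
        _ ≤ _ := by
          have := norm_add_le z₀ (z - z₀)
          rw [Complex.norm_real, Real.norm_of_nonneg hs.le]; linarith
    nlinarith
  rw [Complex.norm_cpow_real]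
  calc ‖z + s‖ ^ r ≤ l ^ (-A) * (C * (1 + s)) ^ A :=
        rpow_le_of_abs_le hl0 (min_le_right _ _) hlow hup (by nlinarith) hr
    _ = l ^ (-A) * (C ^ A * (1 + s) ^ A) := by
        rw [Real.mul_rpow (by linarith) (by linarith)]
    _ ≤ l ^ (-A) * (C ^ A * (2 ^ A * (1 + s ^ A))) := by
        gcongr; exact one_add_rpow_le hs hA
    _ = _ := by ring

theorem integrableOn_gammaMoment {z : ℂ} (hz : z ∈ Complex.slitPlane) (p : ℝ) {c : ℝ}
    (hc : 0 < c) :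
    IntegrableOn (fun s : ℝ => (gammaDensity c s : ℂ) * (z + s) ^ (p : ℂ)) (Ioi 0) := by
  obtain ⟨D, hD, ρ, hρ, -, hb⟩ := exists_norm_add_cpow_le hz (abs_nonneg p)
  refine Integrable.mono' ((integrableOn_gammaDensity_mul_one_add hc (abs_nonneg p)).const_mul D)
    (measurable_gammaMoment_integrand p c z).aestronglyMeasurable ?_
  refine (ae_restrict_iff' measurableSet_Ioi).2 (ae_of_all _ fun s (hs : 0 < s) => ?_)
  have := hb z (Metric.mem_ball_self hρ) s hs p le_rfl
  have hg := gammaDensity_pos hc hs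
  rw [norm_mul, Complex.norm_real, Real.norm_of_nonneg hg.le]
  calc _ ≤ gammaDensity c s * (D * (1 + s ^ |p|)) := by gcongr
    _ = _ := by ring

theorem hasDerivAt_gammaMoment {z : ℂ} (hz : z ∈ Complex.slitPlane) (p : ℝ) {c : ℝ}
    (hc : 0 < c) :
    HasDerivAt (gammaMoment p c) (p * gammaMoment (p - 1) c z) z := by
  obtain ⟨D, hD, ρ, hρ, hsub, hb⟩ := exists_norm_add_cpow_le hz (abs_nonneg (p - 1))
  have key := hasDerivAt_integral_of_dominated_loc_of_deriv_le
    (μ := volume.restrict (Ioi (0 : ℝ)))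
    (F := fun (z : ℂ) (s : ℝ) => (gammaDensity c s : ℂ) * (z + s) ^ (p : ℂ))
    (F' := fun (z : ℂ) (s : ℝ) => p * ((gammaDensity c s : ℂ) * (z + s) ^ ((p - 1 : ℝ) : ℂ)))
    (bound := fun s => |p| * D * (gammaDensity c s * (1 + s ^ |p - 1|)))
    (Metric.ball_mem_nhds z hρ)
    (Eventually.of_forall fun w => (measurable_gammaMoment_integrand p c w).aestronglyMeasurable)
    (integrableOn_gammaMoment hz p hc)
    ((measurable_gammaMoment_integrand (p - 1) c z).const_mul _).aestronglyMeasurable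
    ?_ ((integrableOn_gammaDensity_mul_one_add hc (abs_nonneg _)).const_mul _) ?_
  · have := key.2
    rw [integral_const_mul] at this
    exact this
  · refine (ae_restrict_iff' measurableSet_Ioi).2 (ae_of_all _ fun s (hs : 0 < s) w hw => ?_)
    have h := hb w hw s hs (p - 1) le_rfl
    have hg := gammaDensity_pos hc hs
    rw [norm_mul, norm_mul, Complex.norm_real, Complex.norm_real, Real.norm_of_nonneg hg.le,
      Real.norm_eq_abs]
    calc _ ≤ |p| * (gammaDensity c s * (D * (1 + s ^ |p - 1|))) := by gcongr
      _ = _ := by ring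
  · refine (ae_restrict_iff' measurableSet_Ioi).2 (ae_of_all _ fun s (hs : 0 < s) w hw => ?_)
    have h1 : HasDerivAt (fun w : ℂ => w + s) 1 w := (hasDerivAt_id w).add_const _
    have h2 := (h1.cpow_const (c := (p : ℂ))
      (add_ofReal_mem_slitPlane (hsub hw) hs.le)).const_mul (gammaDensity c s : ℂ)
    refine h2.congr_deriv ?_
    push_cast; ring

theorem analyticOnNhd_gammaMoment (p : ℝ) {c : ℝ} (hc : 0 < c) :
    AnalyticOnNhd ℂ (gammaMoment p c) Complex.slitPlane :=
  DifferentiableOn.analyticOnNhd (fun _ hz =>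
    (hasDerivAt_gammaMoment hz p hc).differentiableAt.differentiableWithinAt)
    Complex.isOpen_slitPlane

theorem gammaMoment_conj {z : ℂ} (hz : z ∈ Complex.slitPlane) (p c : ℝ) :
    gammaMoment p c (starRingEnd ℂ z) = starRingEnd ℂ (gammaMoment p c z) := by
  unfold gammaMoment
  rw [← integral_conj]
  refine setIntegral_congr_fun measurableSet_Ioi fun s (hs : 0 < s) => ?_
  have h := Complex.cpow_conj (starRingEnd ℂ (z + s)) p (by
    have h1 := Complex.slitPlane_arg_ne_pi (add_ofReal_mem_slitPlane hz hs.le)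
    rw [Complex.arg_conj, if_neg h1]
    intro h2
    have := Complex.neg_pi_lt_arg (z + s)
    linarith)
  simp only [map_mul, Complex.conj_ofReal, map_add, Complex.conj_conj] at h ⊢
  rw [h]

/-! ### Contiguous relations between the moments -/

theorem gammaDensity_succ {c s : ℝ} (hc : 0 < c) (hs : 0 < s) :
    s * gammaDensity c s = c * gammaDensity (c + 1) s := by
  have := Real.Gamma_pos_of_pos hc
  unfold gammaDensity
  rw [Real.Gamma_add_one hc.ne', show c + 1 - 1 = (c - 1) + 1 by ring, Real.rpow_add_one hs.ne']
  field_simp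

/-- One factor `z + s` is split off the power, and the factor `s` raises the shape by one. The
counterpart for Tricomi's function is `tricomiFormula_add_one_add_one`. -/
theorem gammaMoment_eq_add {z : ℂ} (hz : z ∈ Complex.slitPlane) (p : ℝ) {c : ℝ} (hc : 0 < c) :
    gammaMoment p c z = z * gammaMoment (p - 1) c z + c * gammaMoment (p - 1) (c + 1) z := by
  unfold gammaMoment
  rw [← integral_const_mul, ← integral_const_mul,
    ← integral_add ((integrableOn_gammaMoment hz _ hc).const_mul _)
      ((integrableOn_gammaMoment hz _ (by linarith)).const_mul _)]
  refine setIntegral_congr_fun measurableSet_Ioi fun s (hs : 0 < s) => ?_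
  have h1 : (s : ℂ) * gammaDensity c s = c * gammaDensity (c + 1) s := by
    exact_mod_cast gammaDensity_succ hc hs
  have h2 : z + s ≠ 0 := Complex.slitPlane_ne_zero (add_ofReal_mem_slitPlane hz hs.le)
  have h3 : (z + s) ^ (p : ℂ) = (z + s) ^ ((p - 1 : ℝ) : ℂ) * (z + s) := by
    rw [Complex.ofReal_sub, Complex.ofReal_one, Complex.cpow_sub _ _ h2, Complex.cpow_one,
      div_mul_cancel₀ _ h2]
  rw [h3, ← mul_assoc (c : ℂ), ← h1]
  ring

theorem hasDerivAt_gammaDensity_succ {c s : ℝ} (hc : 0 < c) (hs : 0 < s) :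
    HasDerivAt (gammaDensity (c + 1)) (gammaDensity c s - gammaDensity (c + 1) s) s := by
  have hG := (Real.Gamma_pos_of_pos hc).ne'
  have h1 : HasDerivAt (fun s : ℝ => Real.exp (-s)) (-Real.exp (-s)) s := by
    simpa using (hasDerivAt_neg s).exp
  have h2 := Real.hasDerivAt_rpow_const (x := s) (p := c) (Or.inl hs.ne')
  have h3 := (h1.mul h2).div_const (Real.Gamma (c + 1))
  have h4 : gammaDensity (c + 1) =
      fun y => ((fun s : ℝ => Real.exp (-s)) * fun x : ℝ => x ^ c) y / Real.Gamma (c + 1) := by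
    ext y; simp [gammaDensity]
  rw [h4]
  refine h3.congr_deriv ?_
  simp only [gammaDensity, Pi.mul_apply]
  rw [Real.Gamma_add_one hc.ne']
  field_simp
  ring

theorem tendsto_gammaDensity_mul_rpow (c A : ℝ) :
    Tendsto (fun s => gammaDensity c s * s ^ A) atTop (𝓝 0) := by
  have h := tendsto_rpow_mul_exp_neg_mul_atTop_nhds_zero (c - 1 + A) 1 one_pos
  have h' := h.div_const (Real.Gamma c)
  rw [zero_div] at h'
  refine h'.congr' ?_
  filter_upwards [eventually_gt_atTop 0] with s hs
  rw [Real.rpow_add hs]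
  simp only [gammaDensity]
  ring_nf

/-- Integration by parts. -/
theorem gammaMoment_succ_sub {z : ℂ} (hz : z ∈ Complex.slitPlane) (p : ℝ) {c : ℝ} (hc : 0 < c) :
    p * gammaMoment (p - 1) (c + 1) z = gammaMoment p (c + 1) z - gammaMoment p c z := by
  have i1 := integrableOn_gammaMoment hz p hc
  have i2 := integrableOn_gammaMoment hz p (c := c + 1) (by linarith)
  have i3 := (integrableOn_gammaMoment hz (p - 1) (c := c + 1) (by linarith)).const_mul (p : ℂ)
  have hderiv : ∀ s ∈ Ioi (0 : ℝ), HasDerivAt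
      (fun s : ℝ => (gammaDensity (c + 1) s : ℂ) * (z + s) ^ (p : ℂ))
      (((gammaDensity c s : ℂ) * (z + s) ^ (p : ℂ) -
        (gammaDensity (c + 1) s : ℂ) * (z + s) ^ (p : ℂ)) +
        p * ((gammaDensity (c + 1) s : ℂ) * (z + s) ^ ((p - 1 : ℝ) : ℂ))) s := by
    intro s (hs : 0 < s)
    have h1 := (hasDerivAt_gammaDensity_succ hc hs).ofReal_comp
    have h2 : HasDerivAt (fun w : ℂ => z + w) 1 (s : ℂ) := (hasDerivAt_id _).const_add _
    have h3 := (h2.cpow_const (c := (p : ℂ)) (add_ofReal_mem_slitPlane hz hs.le)).comp_ofReal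
    refine (h1.mul h3).congr_deriv ?_
    push_cast; ring
  -- No boundary term at `0`: the density of shape `c + 1` contains `s^c` with `c > 0`.
  have hzero : gammaDensity (c + 1) 0 = 0 := by
    simp [gammaDensity, Real.zero_rpow hc.ne']
  obtain ⟨D, hD, ρ, hρ, -, hb⟩ := exists_norm_add_cpow_le hz (abs_nonneg p)
  have hbound : ∀ s : ℝ, 0 < s → ‖(gammaDensity (c + 1) s : ℂ) * (z + s) ^ (p : ℂ)‖ ≤
      D * (gammaDensity (c + 1) s * s ^ (0 : ℝ) + gammaDensity (c + 1) s * s ^ |p|) := by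
    intro s hs
    have := hb z (Metric.mem_ball_self hρ) s hs p le_rfl
    have hg := gammaDensity_pos (c := c + 1) (by linarith) hs
    rw [norm_mul, Complex.norm_real, Real.norm_of_nonneg hg.le, Real.rpow_zero]
    calc _ ≤ gammaDensity (c + 1) s * (D * (1 + s ^ |p|)) := by gcongr
      _ = _ := by ring
  have htop : Tendsto (fun s : ℝ => (gammaDensity (c + 1) s : ℂ) * (z + s) ^ (p : ℂ)) atTop
      (𝓝 0) := by
    have h := ((tendsto_gammaDensity_mul_rpow (c + 1) 0).add
      (tendsto_gammaDensity_mul_rpow (c + 1) |p|)).const_mul D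
    rw [add_zero, mul_zero] at h
    refine squeeze_zero_norm' ?_ h
    filter_upwards [eventually_gt_atTop 0] with s hs using hbound s hs
  have hcont : ContinuousWithinAt
      (fun s : ℝ => (gammaDensity (c + 1) s : ℂ) * (z + s) ^ (p : ℂ)) (Ici 0) 0 := by
    refine ContinuousAt.continuousWithinAt (ContinuousAt.mul ?_ ?_)
    · refine Complex.continuous_ofReal.continuousAt.comp ?_
      unfold gammaDensity
      refine ContinuousAt.div_const (ContinuousAt.mul (by fun_prop) ?_) _
      exact Real.continuousAt_rpow_const _ _ (Or.inr (by linarith))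
    · refine ContinuousAt.cpow (by fun_prop) continuousAt_const ?_
      exact add_ofReal_mem_slitPlane hz le_rfl
  have key := integral_Ioi_of_hasDerivAt_of_tendsto hcont hderiv ((i1.sub i2).add i3) htop
  rw [hzero, Complex.ofReal_zero, zero_mul, sub_zero] at key
  have e1 := integral_add (i1.sub i2) i3
  have e2 := integral_sub i1 i2
  have e3 := integral_const_mul (p : ℂ)
    (fun s : ℝ => (gammaDensity (c + 1) s : ℂ) * (z + s) ^ ((p - 1 : ℝ) : ℂ))
    (μ := volume.restrict (Ioi (0 : ℝ)))
  simp only [Pi.sub_apply] at e1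
  rw [e1, e2, e3] at key
  unfold gammaMoment
  linear_combination key

/-- Take `p = -a`, `c = a - b + 1`, and let `u`, `v` be the moments of shapes `c`, `c + 1`. This is
`z u' = (1 - b) u - c v`, while `gammaMoment_succ_sub` is `v' = v - u`: the system used to identify
`U`. -/
theorem mul_deriv_gammaMoment {z : ℂ} (hz : z ∈ Complex.slitPlane) (p : ℝ) {c : ℝ}
    (hc : 0 < c) :
    z * (p * gammaMoment (p - 1) c z) =
      (c + p) * gammaMoment p c z - c * gammaMoment p (c + 1) z := by
  linear_combination (-p : ℂ) * gammaMoment_eq_add hz p hc - c * gammaMoment_succ_sub hz p hc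

/-! ### Continuity in the parameters and behaviour at the origin -/

/-- Needed for integer `b`. For shapes between `c / 2` and `c + 1` the power of `s` is at most the
sum of the two extreme powers, and `Γ` stays above `Γ(c) / 2`, so two fixed Gamma densities
dominate. -/
theorem tendsto_gammaMoment_param {ι : Type*} {l : Filter ι} [l.IsCountablyGenerated]
    {P C : ι → ℝ} {p c : ℝ} {z : ℂ} (hz : z ∈ Complex.slitPlane) (hc : 0 < c)
    (hP : Tendsto P l (𝓝 p)) (hC : Tendsto C l (𝓝 c)) :
    Tendsto (fun i => gammaMoment (P i) (C i) z) l (𝓝 (gammaMoment p c z)) := by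
  have hA : 0 ≤ |p| + 1 := by positivity
  obtain ⟨D, hD, ρ, hρ, -, hb⟩ := exists_norm_add_cpow_le hz hA
  have hG := Real.Gamma_pos_of_pos hc
  have hG1 := Real.Gamma_pos_of_pos (show 0 < c / 2 by linarith)
  have hG2 := Real.Gamma_pos_of_pos (show 0 < c + 1 by linarith)
  have hcont : ContinuousAt Real.Gamma c := by
    refine (Real.differentiableAt_Gamma fun m hm => ?_).continuousAt
    have : (0 : ℝ) ≤ m := m.cast_nonneg
    linarith
  have hGC : Tendsto (fun i => Real.Gamma (C i)) l (𝓝 (Real.Gamma c)) := hcont.tendsto.comp hC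
  refine tendsto_integral_filter_of_dominated_convergence
    (fun s => D * (2 * Real.Gamma (c / 2) / Real.Gamma c *
      (gammaDensity (c / 2) s * (1 + s ^ (|p| + 1))) +
      2 * Real.Gamma (c + 1) / Real.Gamma c * (gammaDensity (c + 1) s * (1 + s ^ (|p| + 1)))))
    (Eventually.of_forall fun i => (measurable_gammaMoment_integrand _ _ z).aestronglyMeasurable)
    ?_ ?_ ?_
  · have e1 : ∀ᶠ i in l, |P i| ≤ |p| + 1 :=
      (hP.abs.eventually (gt_mem_nhds (lt_add_one |p|))).mono fun _ h => h.le
    have e2 : ∀ᶠ i in l, c / 2 < C i := hC.eventually (lt_mem_nhds (by linarith))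
    have e3 : ∀ᶠ i in l, C i < c + 1 := hC.eventually (gt_mem_nhds (by linarith))
    have e4 : ∀ᶠ i in l, Real.Gamma c / 2 < Real.Gamma (C i) :=
      hGC.eventually (lt_mem_nhds (by linarith))
    filter_upwards [e1, e2, e3, e4] with i h1 h2 h3 h4
    refine (ae_restrict_iff' measurableSet_Ioi).2 (ae_of_all _ fun s (hs : 0 < s) => ?_)
    have hg := gammaDensity_pos (c := C i) (by linarith) hs
    have hw := hb z (Metric.mem_ball_self hρ) s hs (P i) h1
    have hd : gammaDensity (C i) s ≤ 2 * Real.Gamma (c / 2) / Real.Gamma c *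
        gammaDensity (c / 2) s + 2 * Real.Gamma (c + 1) / Real.Gamma c *
        gammaDensity (c + 1) s := by
      have hpow : s ^ (C i - 1) ≤ s ^ (c / 2 - 1) + s ^ (c + 1 - 1) := by
        have p1 := Real.rpow_pos_of_pos hs (c / 2 - 1)
        have p2 := Real.rpow_pos_of_pos hs (c + 1 - 1)
        rcases le_total s 1 with h | h
        · have := Real.rpow_le_rpow_of_exponent_ge hs h (show c / 2 - 1 ≤ C i - 1 by linarith)
          linarith
        · have := Real.rpow_le_rpow_of_exponent_le h (show C i - 1 ≤ c + 1 - 1 by linarith)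
          linarith
      calc gammaDensity (C i) s
          ≤ Real.exp (-s) * (s ^ (c / 2 - 1) + s ^ (c + 1 - 1)) / (Real.Gamma c / 2) := by
            unfold gammaDensity; gcongr
        _ = _ := by unfold gammaDensity; field_simp
    rw [norm_mul, Complex.norm_real, Real.norm_of_nonneg hg.le]
    have hs1 : 0 < s ^ (|p| + 1) := Real.rpow_pos_of_pos hs _
    calc _ ≤ (2 * Real.Gamma (c / 2) / Real.Gamma c *
        gammaDensity (c / 2) s + 2 * Real.Gamma (c + 1) / Real.Gamma c *
        gammaDensity (c + 1) s) * (D * (1 + s ^ (|p| + 1))) := by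
          gcongr; exact hg.le.trans hd
      _ = _ := by ring
  · exact (((integrableOn_gammaDensity_mul_one_add (by linarith) hA).const_mul _).add
      ((integrableOn_gammaDensity_mul_one_add (by linarith) hA).const_mul _)).const_mul D
  · refine (ae_restrict_iff' measurableSet_Ioi).2 (ae_of_all _ fun s (hs : 0 < s) => ?_)
    refine Tendsto.mul ((Complex.continuous_ofReal.tendsto _).comp ?_) ?_
    · unfold gammaDensity
      refine Tendsto.div (Tendsto.const_mul _ ?_) hGC hG.ne'
      exact (Real.continuousAt_const_rpow hs.ne').tendsto.comp (hC.sub_const 1)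
    · have h := Complex.slitPlane_ne_zero (add_ofReal_mem_slitPlane hz hs.le)
      exact (continuousAt_const_cpow h).tendsto.comp
        ((Complex.continuous_ofReal.tendsto p).comp hP)

theorem gammaMoment_ofReal (p c : ℝ) {x : ℝ} (hx : 0 ≤ x) :
    gammaMoment p c x = ((∫ s in Ioi (0 : ℝ), gammaDensity c s * (x + s) ^ p : ℝ) : ℂ) := by
  unfold gammaMoment
  rw [← integral_complex_ofReal]
  refine setIntegral_congr_fun measurableSet_Ioi fun s (hs : 0 < s) => ?_
  rw [Complex.ofReal_mul, Complex.ofReal_cpow (by linarith), Complex.ofReal_add]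

theorem tendsto_gammaMoment_zero {p c : ℝ} (hc : 0 < c) (hcp : 0 < c + p) :
    Tendsto (fun x : ℝ => gammaMoment p c x) (𝓝[>] 0)
      (𝓝 ((Real.Gamma (c + p) / Real.Gamma c : ℝ) : ℂ)) := by
  have h : Tendsto (fun x : ℝ => ∫ s in Ioi (0 : ℝ), gammaDensity c s * (x + s) ^ p) (𝓝[>] 0)
      (𝓝 (∫ s in Ioi (0 : ℝ), gammaDensity c s * s ^ p)) := by
    refine tendsto_integral_filter_of_dominated_convergence
      (fun s => gammaDensity c s * s ^ p + 2 ^ |p| * (gammaDensity c s * (1 + s ^ |p|)))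
      (Eventually.of_forall fun x => ?_) ?_ ?_ ?_
    · have := measurable_gammaDensity c
      exact Measurable.aestronglyMeasurable (by fun_prop)
    · filter_upwards [self_mem_nhdsWithin, Ioo_mem_nhdsGT (zero_lt_one' ℝ)] with x (hx0 : 0 < x) hx1
      refine (ae_restrict_iff' measurableSet_Ioi).2 (ae_of_all _ fun s (hs : 0 < s) => ?_)
      have hg := gammaDensity_pos hc hs
      rw [Real.norm_of_nonneg (by positivity)]
      have h1 : (x + s) ^ p ≤ s ^ p + 2 ^ |p| * (1 + s ^ |p|) := by
        rcases le_total 0 p with hp | hp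
        · rw [abs_of_nonneg hp]
          have h2 := one_add_rpow_le hs hp
          have h3 : (x + s) ^ p ≤ (1 + s) ^ p :=
            Real.rpow_le_rpow (by linarith) (by linarith [hx1.2]) hp
          have := Real.rpow_pos_of_pos hs p
          linarith
        · have h2 := Real.rpow_le_rpow_of_nonpos hs (show s ≤ x + s by linarith) hp
          have : 0 < (2 : ℝ) ^ |p| * (1 + s ^ |p|) := by positivity
          linarith
      calc _ ≤ gammaDensity c s * (s ^ p + 2 ^ |p| * (1 + s ^ |p|)) := by gcongr
        _ = _ := by ring
    · exact (integrableOn_gammaDensity_mul_rpow hcp).add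
        ((integrableOn_gammaDensity_mul_one_add hc (abs_nonneg p)).const_mul _)
    · refine (ae_restrict_iff' measurableSet_Ioi).2 (ae_of_all _ fun s (hs : 0 < s) => ?_)
      refine Tendsto.const_mul _ ?_
      have : ContinuousAt (fun x : ℝ => (x + s) ^ p) 0 :=
        ContinuousAt.rpow_const (by fun_prop) (Or.inl (by simpa using hs.ne'))
      simpa using this.tendsto.mono_left nhdsWithin_le_nhds
  rw [integral_gammaDensity_mul_rpow hcp] at h
  refine ((Complex.continuous_ofReal.tendsto _).comp h).congr' ?_
  filter_upwards [self_mem_nhdsWithin] with x (hx : 0 < x)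
  exact (gammaMoment_ofReal p c hx.le).symm

/-- The Beta integral over the half-line. -/
theorem integral_rpow_mul_one_add_rpow {b c : ℝ} (hb : 0 < b) (hc : 0 < c) :
    ∫ t in Ioi (0 : ℝ), t ^ (c - 1) * (1 + t) ^ (-(b + c)) =
      Real.Gamma c * Real.Gamma b / Real.Gamma (c + b) := by
  have himg : (fun u : ℝ => u / (1 - u)) '' Ioo 0 1 = Ioi 0 := by
    ext t
    constructor
    · rintro ⟨u, ⟨h0, h1⟩, rfl⟩
      exact div_pos h0 (by linarith)
    · intro (ht : 0 < t)
      refine ⟨t / (1 + t), ⟨by positivity, (div_lt_one (by positivity)).2 (by linarith)⟩, ?_⟩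
      have : (1 + t) ≠ 0 := by positivity
      field_simp
      ring
  have hinj : InjOn (fun u : ℝ => u / (1 - u)) (Ioo 0 1) := by
    intro u hu v hv huv
    have h1 : 1 - u ≠ 0 := by linarith [hu.2]
    have h2 : 1 - v ≠ 0 := by linarith [hv.2]
    simp only at huv
    rw [div_eq_div_iff h1 h2] at huv
    linarith
  have hder : ∀ u ∈ Ioo (0 : ℝ) 1, HasDerivWithinAt (fun u : ℝ => u / (1 - u))
      (((1 - u) ^ 2)⁻¹) (Ioo 0 1) u := by
    intro u hu
    have h1 : 1 - u ≠ 0 := by linarith [hu.2]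
    have := ((hasDerivAt_id u).div ((hasDerivAt_id u).const_sub 1) h1)
    refine (this.congr_deriv ?_).hasDerivWithinAt
    simp only [id]
    field_simp
    ring
  have h := integral_image_eq_integral_abs_deriv_smul measurableSet_Ioo hder hinj
    (fun t : ℝ => t ^ (c - 1) * (1 + t) ^ (-(b + c)))
  rw [himg] at h
  rw [h, show Real.Gamma c * Real.Gamma b / Real.Gamma (c + b) = ProbabilityTheory.beta c b from rfl,
    ProbabilityTheory.beta_eq_betaIntegralReal _ _ hc hb, Complex.betaIntegral,
    intervalIntegral.integral_of_le zero_le_one, ← integral_Ioc_eq_integral_Ioo]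
  rw [← Complex.ofReal_re (∫ x in Ioc (0 : ℝ) 1, _), ← integral_complex_ofReal,
    integral_Ioc_eq_integral_Ioo, integral_Ioc_eq_integral_Ioo]
  congr 1
  refine setIntegral_congr_fun measurableSet_Ioo fun u ⟨h0, h1⟩ => ?_
  have h2 : 0 < 1 - u := by linarith
  have e1 : 1 + u / (1 - u) = (1 - u)⁻¹ := by field_simp; ring
  simp only [smul_eq_mul]
  rw [abs_of_pos (by positivity), e1, Real.div_rpow h0.le h2.le, Real.inv_rpow h2.le,
    Real.rpow_neg h2.le, inv_inv]
  have e2 : ((1 - u) ^ 2)⁻¹ * (u ^ (c - 1) / (1 - u) ^ (c - 1) * (1 - u) ^ (b + c)) =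
      u ^ (c - 1) * (1 - u) ^ (b - 1) := by
    have e3 : (1 - u) ^ (b + c) = (1 - u) ^ (b - 1) * (1 - u) ^ (c - 1) * (1 - u) ^ 2 := by
      rw [← Real.rpow_natCast (1 - u) 2, ← Real.rpow_add h2, ← Real.rpow_add h2]
      congr 1; push_cast; ring
    rw [e3]
    have := (Real.rpow_pos_of_pos h2 (c - 1)).ne'
    field_simp
  rw [e2]
  push_cast
  rw [Complex.ofReal_cpow h0.le, Complex.ofReal_cpow h2.le]
  push_cast
  rfl

/-- The substitution `s = x t` turns the product into `1/Γ(c)` times the integral of `e^(-xt)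
t^(c-1) (1+t)^(-(b+c))`, which tends to a Beta integral. -/
theorem tendsto_rpow_mul_gammaMoment_zero {b c : ℝ} (hb : 0 < b) (hc : 0 < c) :
    Tendsto (fun x : ℝ => ((x ^ b : ℝ) : ℂ) * gammaMoment (-(b + c)) c x) (𝓝[>] 0)
      (𝓝 ((Real.Gamma b / Real.Gamma (b + c) : ℝ) : ℂ)) := by
  have hG := Real.Gamma_pos_of_pos hc
  have hGb := Real.Gamma_pos_of_pos hb
  have hGbc := Real.Gamma_pos_of_pos (add_pos hb hc)
  -- Integrability follows from the known value: a non-integrable function would have integral `0`,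
  -- but the value is positive.
  have hint : IntegrableOn (fun t : ℝ => t ^ (c - 1) * (1 + t) ^ (-(b + c))) (Ioi 0) := by
    by_contra hn
    have h := integral_rpow_mul_one_add_rpow hb hc
    rw [integral_undef hn, add_comm c b] at h
    have : 0 < Real.Gamma c * Real.Gamma b / Real.Gamma (b + c) := by positivity
    linarith
  have h : Tendsto (fun x : ℝ => ∫ t in Ioi (0 : ℝ),
      Real.exp (-(x * t)) * (t ^ (c - 1) * (1 + t) ^ (-(b + c)))) (𝓝[>] 0)
      (𝓝 (∫ t in Ioi (0 : ℝ), t ^ (c - 1) * (1 + t) ^ (-(b + c)))) := by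
    refine tendsto_integral_filter_of_dominated_convergence
      (fun t : ℝ => t ^ (c - 1) * (1 + t) ^ (-(b + c)))
      (Eventually.of_forall fun x => Measurable.aestronglyMeasurable (by fun_prop)) ?_ hint ?_
    · filter_upwards [self_mem_nhdsWithin] with x (hx0 : 0 < x)
      refine (ae_restrict_iff' measurableSet_Ioi).2 (ae_of_all _ fun t (ht : 0 < t) => ?_)
      rw [Real.norm_of_nonneg (by positivity)]
      refine mul_le_of_le_one_left (by positivity) (Real.exp_le_one_iff.2 ?_)
      have := mul_pos hx0 ht
      linarith
    · refine ae_of_all _ fun t => ?_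
      have : Continuous fun x : ℝ =>
        Real.exp (-(x * t)) * (t ^ (c - 1) * (1 + t) ^ (-(b + c))) := by fun_prop
      simpa using (this.tendsto 0).mono_left nhdsWithin_le_nhds
  rw [integral_rpow_mul_one_add_rpow hb hc, add_comm c b] at h
  have h2 := h.div_const (Real.Gamma c)
  rw [show Real.Gamma c * Real.Gamma b / Real.Gamma (b + c) / Real.Gamma c =
    Real.Gamma b / Real.Gamma (b + c) by field_simp] at h2
  refine ((Complex.continuous_ofReal.tendsto _).comp h2).congr' ?_
  filter_upwards [self_mem_nhdsWithin] with x (hx : 0 < x)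
  rw [gammaMoment_ofReal _ _ hx.le, ← Complex.ofReal_mul]
  simp only [Function.comp]
  congr 1
  have hs := integral_comp_mul_left_Ioi'
    (fun s => gammaDensity c s * (x + s) ^ (-(b + c))) 0 hx
  rw [mul_zero] at hs
  rw [← hs, smul_eq_mul, ← integral_const_mul, ← integral_const_mul, ← integral_div]
  refine setIntegral_congr_fun measurableSet_Ioi fun t (ht : 0 < t) => ?_
  simp only [gammaDensity]
  rw [show x + x * t = x * (1 + t) by ring, Real.mul_rpow hx.le ht.le,
    Real.mul_rpow hx.le (by linarith)]
  have e : x ^ b * x * (x ^ (c - 1) * x ^ (-(b + c))) = 1 := by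
    nth_rewrite 2 [← Real.rpow_one x]
    rw [← Real.rpow_add hx, ← Real.rpow_add hx, ← Real.rpow_add hx]
    rw [show b + 1 + (c - 1 + -(b + c)) = 0 by ring, Real.rpow_zero]
  linear_combination (-(Real.exp (-(x * t)) * t ^ (c - 1) * (1 + t) ^ (-(b + c)) / Real.Gamma c)) * e

/-! ### Kummer's series and its contiguous relations -/

/-- The Taylor coefficients of `kummerM a b` at `0`. -/
noncomputable def kummerCoeff (a b : ℝ) (r : ℕ) : ℝ :=
  (ascPochhammer ℝ r).eval a / (ascPochhammer ℝ r).eval b / r.factorial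

theorem kummerM_eq_tsum (a b : ℝ) (z : ℂ) :
    kummerM a b z = ∑' r : ℕ, (kummerCoeff a b r : ℂ) * z ^ r := by
  unfold kummerM kummerCoeff
  congr 1
  ext r
  push_cast
  ring

theorem kummerCoeff_succ (a b : ℝ) (r : ℕ) :
    kummerCoeff a b (r + 1) = kummerCoeff a b r * ((a + r) / ((b + r) * (r + 1))) := by
  unfold kummerCoeff
  rw [ascPochhammer_succ_eval, ascPochhammer_succ_eval, Nat.factorial_succ]
  push_cast
  simp only [div_eq_mul_inv, mul_inv]
  ring

theorem summable_kummerCoeff (a b R : ℝ) : Summable fun r : ℕ => |kummerCoeff a b r| * |R| ^ r := by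
  refine summable_of_ratio_norm_eventually_le (r := 1 / 2) (by norm_num) ?_
  -- The first summand ensures `0 ≤ a + r ≤ 2 (b + r)`, so the ratio of terms is at most
  -- `2|R|/(r+1)`; the second makes this at most `1/2`.
  filter_upwards [eventually_ge_atTop (⌈|a| + 2 * |b| + 1⌉₊ + ⌈4 * |R|⌉₊)] with r hr
  have h1 : |a| + 2 * |b| + 1 ≤ r := (Nat.le_ceil _).trans (by exact_mod_cast le_of_add_le_left hr)
  have h2 : 4 * |R| ≤ r := (Nat.le_ceil _).trans (by exact_mod_cast le_of_add_le_right hr)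
  have hb := neg_abs_le b
  have ha := le_abs_self a
  have ha' := neg_abs_le a
  have hb' := abs_nonneg b
  have hbr : 0 < b + r := by linarith
  have har : 0 ≤ a + r := by linarith
  have hr1 : (0 : ℝ) < r + 1 := by positivity
  rw [kummerCoeff_succ, abs_mul, pow_succ]
  rw [Real.norm_of_nonneg (by positivity), Real.norm_of_nonneg (by positivity),
    abs_of_nonneg (by positivity : 0 ≤ (a + r) / ((b + r) * (r + 1)))]
  have h3 : (a + r) / ((b + r) * (r + 1)) * |R| ≤ 1 / 2 := by
    rw [div_mul_eq_mul_div, div_le_iff₀ (by positivity)]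
    have h4 : a + r ≤ 2 * (b + r) := by linarith
    nlinarith [abs_nonneg R, mul_nonneg hbr.le (abs_nonneg R)]
  have h5 : 0 ≤ |kummerCoeff a b r| * |R| ^ r := by positivity
  nlinarith

theorem hasSum_kummerM (a b : ℝ) (z : ℂ) :
    HasSum (fun r : ℕ => (kummerCoeff a b r : ℂ) * z ^ r) (kummerM a b z) := by
  rw [kummerM_eq_tsum]
  refine Summable.hasSum (Summable.of_norm ?_)
  refine (summable_kummerCoeff a b ‖z‖).congr fun r => ?_
  rw [norm_mul, norm_pow, Complex.norm_real, Real.norm_eq_abs, abs_norm]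

theorem hasDerivAt_kummerM_tsum (a b : ℝ) (z : ℂ) :
    HasDerivAt (kummerM a b) (∑' r : ℕ, (kummerCoeff a b r : ℂ) * (r * z ^ (r - 1))) z ∧
    Summable fun r : ℕ => (kummerCoeff a b r : ℂ) * (r * z ^ (r - 1)) := by
  set R : ℝ := ‖z‖ + 1 with hR
  have hR1 : 1 ≤ R := by simp [hR]
  -- The factor `r` from differentiation is absorbed by `r ≤ 2^r`, whence the doubled radius.
  have hbound : ∀ (r : ℕ) (y : ℂ), y ∈ Metric.ball (0 : ℂ) R →
      ‖(kummerCoeff a b r : ℂ) * (r * y ^ (r - 1))‖ ≤ |kummerCoeff a b r| * |2 * R| ^ r := by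
    intro r y hy
    have hy' : ‖y‖ ≤ R := by simpa using (mem_ball_zero_iff.1 hy).le
    rw [norm_mul, norm_mul, norm_pow, Complex.norm_real, Real.norm_eq_abs, Complex.norm_natCast,
      abs_of_nonneg (by positivity : 0 ≤ 2 * R), mul_pow]
    have h1 : (r : ℝ) ≤ 2 ^ r := by exact_mod_cast Nat.lt_two_pow_self.le
    have h2 : ‖y‖ ^ (r - 1) ≤ R ^ r :=
      (pow_le_pow_left₀ (norm_nonneg y) hy' _).trans (pow_le_pow_right₀ hR1 (Nat.sub_le r 1))
    gcongr
  have hz : z ∈ Metric.ball (0 : ℂ) R := by simp [hR]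
  constructor
  · have h := hasDerivAt_tsum_of_isPreconnected (summable_kummerCoeff a b (2 * R))
      Metric.isOpen_ball (convex_ball (0 : ℂ) R).isPreconnected
      (g := fun (r : ℕ) (y : ℂ) => (kummerCoeff a b r : ℂ) * y ^ r)
      (fun r y _ => (hasDerivAt_pow r y).const_mul _) hbound hz (hasSum_kummerM a b z).summable hz
    rw [show kummerM a b = fun y => ∑' r : ℕ, (kummerCoeff a b r : ℂ) * y ^ r from
      funext (kummerM_eq_tsum a b)]
    exact h
  · exact Summable.of_norm_bounded (summable_kummerCoeff a b (2 * R)) fun r => hbound r z hz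

theorem ascPochhammer_eval_succ_left (a : ℝ) (r : ℕ) :
    (ascPochhammer ℝ (r + 1)).eval a = a * (ascPochhammer ℝ r).eval (a + 1) := by
  rw [ascPochhammer_succ_left]
  simp

theorem ascPochhammer_eval_ne_zero {b : ℝ} (hb : ∀ n : ℤ, (n : ℝ) ≠ b) (r : ℕ) :
    (ascPochhammer ℝ r).eval b ≠ 0 := by
  induction r with
  | zero => simp
  | succ r ih =>
    rw [ascPochhammer_succ_eval]
    refine mul_ne_zero ih fun h => hb (-r) ?_
    push_cast
    linarith

theorem kummerCoeff_succ_left (a b : ℝ) (r : ℕ) :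
    kummerCoeff a b (r + 1) * (r + 1) = a / b * kummerCoeff (a + 1) (b + 1) r := by
  have h1 : ((r : ℝ) + 1) ≠ 0 := by positivity
  unfold kummerCoeff
  rw [ascPochhammer_eval_succ_left, ascPochhammer_eval_succ_left, Nat.factorial_succ]
  push_cast
  field_simp

theorem hasDerivAt_kummerM (a b : ℝ) (z : ℂ) :
    HasDerivAt (kummerM a b) (((a / b : ℝ) : ℂ) * kummerM (a + 1) (b + 1) z) z := by
  obtain ⟨h, hs⟩ := hasDerivAt_kummerM_tsum a b z
  convert h using 1
  symm
  have h2 := (hasSum_kummerM (a + 1) (b + 1) z).mul_left ((a / b : ℝ) : ℂ)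
  have h3 := (hasSum_nat_add_iff (f := fun r : ℕ => (kummerCoeff a b r : ℂ) * (r * z ^ (r - 1)))
    1).1 (h2.congr_fun ?_)
  · simpa using h3.tsum_eq
  · intro r
    have := kummerCoeff_succ_left a b r
    have h4 : (kummerCoeff a b (r + 1) : ℂ) * ((r : ℂ) + 1) =
        ((a / b : ℝ) : ℂ) * (kummerCoeff (a + 1) (b + 1) r : ℂ) := by exact_mod_cast this
    simp only [Nat.add_sub_cancel]
    push_cast at h4 ⊢
    linear_combination z ^ r * h4

/-- On `z^r` the operator `z d/dz` is multiplication by `r`, and `(b-1)_r (b-1+r) = (b-1) (b)_r`. -/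
theorem mul_deriv_kummerM {b : ℝ} (hb : ∀ n : ℤ, (n : ℝ) ≠ b) (a : ℝ) (z : ℂ) :
    z * (((a / b : ℝ) : ℂ) * kummerM (a + 1) (b + 1) z) + (b - 1) * kummerM a b z =
      (b - 1) * kummerM a (b - 1) z := by
  obtain ⟨h, hs⟩ := hasDerivAt_kummerM_tsum a b z
  have hb1 : ∀ n : ℤ, (n : ℝ) ≠ b - 1 := fun n hn => hb (n + 1) (by push_cast; linarith)
  rw [(hasDerivAt_kummerM a b z).unique h]
  refine ((hs.hasSum.mul_left z).add ((hasSum_kummerM a b z).mul_left _)).unique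
    (((hasSum_kummerM a (b - 1) z).mul_left _).congr_fun fun r => ?_)
  have key : kummerCoeff a b r * (b - 1 + r) = (b - 1) * kummerCoeff a (b - 1) r := by
    have e : (ascPochhammer ℝ r).eval (b - 1) * (b - 1 + r) =
        (b - 1) * (ascPochhammer ℝ r).eval b := by
      rw [← ascPochhammer_succ_eval, ascPochhammer_eval_succ_left, sub_add_cancel]
    have h1 := ascPochhammer_eval_ne_zero hb r
    have h2 := ascPochhammer_eval_ne_zero hb1 r
    unfold kummerCoeff
    field_simp
    linear_combination (ascPochhammer ℝ r).eval a * e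
  have key' : (kummerCoeff a b r : ℂ) * (b - 1 + r) = (b - 1) * kummerCoeff a (b - 1) r := by
    exact_mod_cast key
  cases r with
  | zero => simp only [Nat.cast_zero, add_zero, zero_mul, mul_zero, zero_add] at key' ⊢; linear_combination z ^ 0 * key'
  | succ r =>
    simp only [Nat.add_sub_cancel]
    linear_combination z ^ (r + 1) * key'

/-- Coefficientwise this is `(a+1)_(r+1) - (a)_(r+1) = (r+1) (a+1)_r`, with the index shifted by
one. -/
theorem kummerM_succ_left {b : ℝ} (hb : ∀ n : ℤ, (n : ℝ) ≠ b) (a : ℝ) (z : ℂ) :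
    kummerM (a + 1) b z = kummerM a b z + z / b * kummerM (a + 1) (b + 1) z := by
  have h2 := (hasSum_kummerM (a + 1) (b + 1) z).mul_left (z / b)
  have hb1 : ∀ n : ℤ, (n : ℝ) ≠ b + 1 := fun n hn => hb (n - 1) (by push_cast; linarith)
  have hb0 : b ≠ 0 := fun h => hb 0 (by simp [h])
  have h3 := (hasSum_nat_add_iff (f := fun r : ℕ => (kummerCoeff (a + 1) b r : ℂ) * z ^ r -
    (kummerCoeff a b r : ℂ) * z ^ r) 1).1 (h2.congr_fun fun r => ?_)
  · have h4 := h3.unique ((hasSum_kummerM (a + 1) b z).sub (hasSum_kummerM a b z))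
    simp only [Finset.range_one, Finset.sum_singleton, kummerCoeff] at h4
    simp at h4
    linear_combination -h4
  · have key : kummerCoeff (a + 1) b (r + 1) - kummerCoeff a b (r + 1) =
        kummerCoeff (a + 1) (b + 1) r / b := by
      have h1 := ascPochhammer_eval_ne_zero hb1 r
      have h5 : ((r : ℝ) + 1) ≠ 0 := by positivity
      unfold kummerCoeff
      rw [ascPochhammer_succ_eval _ (a + 1), ascPochhammer_eval_succ_left a,
        ascPochhammer_eval_succ_left b, Nat.factorial_succ]
      push_cast
      field_simp
      ring
    have key' : (kummerCoeff (a + 1) b (r + 1) : ℂ) - kummerCoeff a b (r + 1) =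
        kummerCoeff (a + 1) (b + 1) r / b := by exact_mod_cast key
    linear_combination z ^ (r + 1) * key'

/-- Over the common denominator `b (b+1)_r r!` the coefficients on the left are `(a)_r (a+r)` and
`(a)_r (b+r)`. -/
theorem deriv_kummerM_sub {b : ℝ} (hb : ∀ n : ℤ, (n : ℝ) ≠ b) (a : ℝ) (z : ℂ) :
    ((a / b : ℝ) : ℂ) * kummerM (a + 1) (b + 1) z - kummerM a b z =
      (((a - b) / b : ℝ) : ℂ) * kummerM a (b + 1) z := by
  have hb1 : ∀ n : ℤ, (n : ℝ) ≠ b + 1 := fun n hn => hb (n - 1) (by push_cast; linarith)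
  have hb0 : b ≠ 0 := fun h => hb 0 (by simp [h])
  refine (((hasSum_kummerM (a + 1) (b + 1) z).mul_left _).sub (hasSum_kummerM a b z)).unique
    (((hasSum_kummerM a (b + 1) z).mul_left _).congr_fun fun r => ?_)
  have key : a / b * kummerCoeff (a + 1) (b + 1) r - kummerCoeff a b r =
      (a - b) / b * kummerCoeff a (b + 1) r := by
    have e1 : (ascPochhammer ℝ r).eval a * (a + r) = a * (ascPochhammer ℝ r).eval (a + 1) := by
      rw [← ascPochhammer_succ_eval, ascPochhammer_eval_succ_left]
    have e2 : (ascPochhammer ℝ r).eval b * (b + r) = b * (ascPochhammer ℝ r).eval (b + 1) := by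
      rw [← ascPochhammer_succ_eval, ascPochhammer_eval_succ_left]
    have h1 := ascPochhammer_eval_ne_zero hb1 r
    have h2 := ascPochhammer_eval_ne_zero hb r
    unfold kummerCoeff
    field_simp
    linear_combination -((ascPochhammer ℝ r).eval b) * e1 + (ascPochhammer ℝ r).eval a * e2
  have key' : ((a / b : ℝ) : ℂ) * kummerCoeff (a + 1) (b + 1) r - kummerCoeff a b r =
      (((a - b) / b : ℝ) : ℂ) * kummerCoeff a (b + 1) r := by exact_mod_cast key
  linear_combination z ^ r * key'

theorem kummerM_zero (a b : ℝ) : kummerM a b 0 = 1 := by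
  rw [kummerM_eq_tsum, tsum_eq_single 0 (fun r hr => by simp [hr])]
  simp [kummerCoeff]

theorem continuous_kummerM (a b : ℝ) : Continuous (kummerM a b) :=
  continuous_iff_continuousAt.2 fun z => (hasDerivAt_kummerM_tsum a b z).1.continuousAt

/-! ### The first-order system, its Wronskian and its solutions -/

theorem isPreconnected_slitPlane : IsPreconnected Complex.slitPlane :=
  (Complex.starConvex_one_slitPlane.isPathConnected Complex.one_mem_slitPlane).isConnected.isPreconnected

/-- Liouville's formula: the system has trace `(1 - b)/z + 1`, for which `z^(b-1) e^(-z)` is the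
integrating factor. -/
theorem wronskian_const {b c : ℂ} {u₁ v₁ u₂ v₂ : ℂ → ℂ}
    (hu₁ : ∀ z ∈ Complex.slitPlane, HasDerivAt u₁ (((1 - b) * u₁ z - c * v₁ z) / z) z)
    (hv₁ : ∀ z ∈ Complex.slitPlane, HasDerivAt v₁ (v₁ z - u₁ z) z)
    (hu₂ : ∀ z ∈ Complex.slitPlane, HasDerivAt u₂ (((1 - b) * u₂ z - c * v₂ z) / z) z)
    (hv₂ : ∀ z ∈ Complex.slitPlane, HasDerivAt v₂ (v₂ z - u₂ z) z) :
    ∃ k, ∀ z ∈ Complex.slitPlane,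
      (u₁ z * v₂ z - u₂ z * v₁ z) * z ^ (b - 1) * Complex.exp (-z) = k := by
  have hd : ∀ z ∈ Complex.slitPlane, HasDerivAt
      (fun z => (u₁ z * v₂ z - u₂ z * v₁ z) * z ^ (b - 1) * Complex.exp (-z)) 0 z := by
    intro z hz
    have hz0 := Complex.slitPlane_ne_zero hz
    have h1 := (((hu₁ z hz).mul (hv₂ z hz)).sub ((hu₂ z hz).mul (hv₁ z hz)))
    have h2 := (hasDerivAt_id z).cpow_const (c := b - 1) hz
    have h3 := (hasDerivAt_neg z).cexp
    refine ((h1.mul h2).mul h3).congr_deriv ?_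
    simp only [id, Pi.mul_apply, Pi.sub_apply]
    rw [Complex.cpow_sub (b - 1) 1 hz0, Complex.cpow_one]
    field_simp
    ring
  refine Complex.isOpen_slitPlane.exists_is_const_of_deriv_eq_zero isPreconnected_slitPlane
    (fun z hz => (hd z hz).differentiableAt.differentiableWithinAt) fun z hz => (hd z hz).deriv

/-- With `hasDerivAt_kummerM_pred`: the pair `M(a,b)`, `(1-b) M(a,b-1)/c` solves the system for `c =
a - b + 1 ≠ 0`. -/
theorem hasDerivAt_kummerM_system {b : ℝ} (hb : ∀ n : ℤ, (n : ℝ) ≠ b) (a : ℝ) {z : ℂ}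
    (hz : z ≠ 0) :
    HasDerivAt (kummerM a b)
      (((1 - b) * kummerM a b z - (1 - b) * kummerM a (b - 1) z) / z) z := by
  refine (hasDerivAt_kummerM a b z).congr_deriv ?_
  rw [eq_div_iff hz]
  linear_combination mul_deriv_kummerM hb a z

theorem hasDerivAt_kummerM_pred {b : ℝ} (hb : ∀ n : ℤ, (n : ℝ) ≠ b) (a : ℝ) (z : ℂ) :
    HasDerivAt (fun z => (1 - b) * kummerM a (b - 1) z)
      ((1 - b) * kummerM a (b - 1) z - (a - b + 1) * kummerM a b z) z := by
  have hb1 : ∀ n : ℤ, (n : ℝ) ≠ b - 1 := fun n hn => hb (n + 1) (by push_cast; linarith)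
  refine ((hasDerivAt_kummerM a (b - 1) z).const_mul (1 - (b : ℂ))).congr_deriv ?_
  have h := deriv_kummerM_sub hb1 a z
  rw [sub_add_cancel] at h ⊢
  have hb0 : (b : ℂ) - 1 ≠ 0 := by
    have : b - 1 ≠ 0 := fun h => hb1 0 (by simp [h])
    exact_mod_cast this
  push_cast at h ⊢
  have h2 : (1 - (b : ℂ)) * ((a - (b - 1)) / (b - 1)) = -(a - b + 1) := by
    field_simp; ring
  linear_combination (1 - (b : ℂ)) * h + kummerM a b z * h2

/-- The first equation for the second solution, whose components are `z^(1-b) M(c,2-b)` and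
`-z^(2-b) M(c+1,3-b)/(2-b)`. -/
theorem hasDerivAt_cpow_mul_kummerM (b c : ℝ) {z : ℂ}
    (hz : z ∈ Complex.slitPlane) :
    HasDerivAt (fun z => z ^ ((1 - b : ℝ) : ℂ) * kummerM c (2 - b) z)
      (((1 - b) * (z ^ ((1 - b : ℝ) : ℂ) * kummerM c (2 - b) z) +
        c / (2 - b) * (z ^ ((2 - b : ℝ) : ℂ) * kummerM (c + 1) (3 - b) z)) / z) z := by
  have hz0 := Complex.slitPlane_ne_zero hz
  have h1 := (hasDerivAt_id z).cpow_const (c := ((1 - b : ℝ) : ℂ)) hz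
  refine (h1.mul (hasDerivAt_kummerM c (2 - b) z)).congr_deriv ?_
  have e : z ^ ((2 - b : ℝ) : ℂ) = z ^ ((1 - b : ℝ) : ℂ) * z := by
    rw [show ((2 - b : ℝ) : ℂ) = ((1 - b : ℝ) : ℂ) + 1 by push_cast; ring, Complex.cpow_add _ _ hz0,
      Complex.cpow_one]
  simp only [id]
  rw [e, Complex.cpow_sub _ 1 hz0, Complex.cpow_one, show 2 - b + 1 = 3 - b by ring]
  push_cast
  field_simp

theorem hasDerivAt_cpow_mul_kummerM_succ {b : ℝ} (hb : ∀ n : ℤ, (n : ℝ) ≠ b) (c : ℝ) {z : ℂ}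
    (hz : z ∈ Complex.slitPlane) :
    HasDerivAt (fun z => -(z ^ ((2 - b : ℝ) : ℂ) * kummerM (c + 1) (3 - b) z) / (2 - b))
      (-(z ^ ((2 - b : ℝ) : ℂ) * kummerM (c + 1) (3 - b) z) / (2 - b) -
        z ^ ((1 - b : ℝ) : ℂ) * kummerM c (2 - b) z) z := by
  have hz0 := Complex.slitPlane_ne_zero hz
  have hb2 : ∀ n : ℤ, (n : ℝ) ≠ 2 - b := fun n hn => hb (2 - n) (by push_cast; linarith)
  have hb3 : ∀ n : ℤ, (n : ℝ) ≠ 3 - b := fun n hn => hb (3 - n) (by push_cast; linarith)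
  have hne : (2 : ℂ) - b ≠ 0 := by
    have : 2 - b ≠ 0 := fun h => hb2 0 (by simp [h])
    exact_mod_cast this
  have h1 := (hasDerivAt_id z).cpow_const (c := ((2 - b : ℝ) : ℂ)) hz
  refine ((h1.mul (hasDerivAt_kummerM (c + 1) (3 - b) z)).neg.div_const _).congr_deriv ?_
  have e : z ^ ((2 - b : ℝ) : ℂ) = z ^ ((1 - b : ℝ) : ℂ) * z := by
    rw [show ((2 - b : ℝ) : ℂ) = ((1 - b : ℝ) : ℂ) + 1 by push_cast; ring, Complex.cpow_add _ _ hz0,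
      Complex.cpow_one]
  have r1 := mul_deriv_kummerM hb3 (c + 1) z
  have r4 := kummerM_succ_left hb2 c z
  rw [show 3 - b - 1 = 2 - b by ring] at r1
  rw [show 2 - b + 1 = 3 - b by ring] at r4
  simp only [id]
  rw [show ((2 - b : ℝ) : ℂ) - 1 = ((1 - b : ℝ) : ℂ) by push_cast; ring, e]
  push_cast at r1 r4 ⊢
  field_simp at r4
  have hdiv : ∀ X Y Z : ℂ, X = Y - (2 - b) * Z → X / (2 - (b : ℂ)) = Y / (2 - b) - Z := by
    intro X Y Z h
    rw [h]; field_simp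
  apply hdiv
  linear_combination (-z ^ (1 - b : ℂ)) * r1 - z ^ (1 - b : ℂ) * r4

/-- The Gamma factors shift so that `U(a,b-1)` is the same combination of the second components as
`U(a,b)` is of the first. -/
theorem tricomiFormula_pred (a b : ℝ) {z : ℂ} (hb : ∀ n : ℤ, (n : ℝ) ≠ b) (hc : 0 < a - b + 1) :
    ((a - b + 1 : ℝ) : ℂ) * tricomiFormula a (b - 1) z =
      ((Real.Gamma (1 - b) / Real.Gamma (a - b + 1) : ℝ) : ℂ) * ((1 - b) * kummerM a (b - 1) z) -
      ((Real.Gamma (b - 1) / Real.Gamma a : ℝ) : ℂ) * (((a - b + 1 : ℝ) : ℂ) / (2 - b) *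
        (z ^ ((2 - b : ℝ) : ℂ) * kummerM (a - b + 1 + 1) (3 - b) z)) := by
  have hb1 : 1 - b ≠ 0 := fun h => hb 1 (by push_cast; linarith)
  have hb2 : 2 - b ≠ 0 := fun h => hb 2 (by push_cast; linarith)
  have hb2' : (2 : ℂ) - b ≠ 0 := by exact_mod_cast hb2
  unfold tricomiFormula
  have e1 : (a - b + 1) * (Real.Gamma (1 - (b - 1)) / Real.Gamma (a - (b - 1) + 1)) =
      Real.Gamma (1 - b) / Real.Gamma (a - b + 1) * (1 - b) := by
    rw [show 1 - (b - 1) = (1 - b) + 1 by ring, show a - (b - 1) + 1 = (a - b + 1) + 1 by ring,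
      Real.Gamma_add_one hb1, Real.Gamma_add_one hc.ne']
    field_simp
  have e2 : Real.Gamma (b - 1 - 1) / Real.Gamma a =
      -(Real.Gamma (b - 1) / Real.Gamma a / (2 - b)) := by
    have h3 : b - 1 - 1 ≠ 0 := fun h => hb2 (by linarith)
    have := Real.Gamma_add_one h3
    rw [sub_add_cancel] at this
    rw [this]
    field_simp
    ring
  have e1' : ((a - b + 1 : ℝ) : ℂ) *
      ((Real.Gamma (1 - (b - 1)) / Real.Gamma (a - (b - 1) + 1) : ℝ) : ℂ) =
      ((Real.Gamma (1 - b) / Real.Gamma (a - b + 1) : ℝ) : ℂ) * (1 - b) := by exact_mod_cast e1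
  rw [e2, show 1 - (b - 1) = 2 - b by ring, show a - (b - 1) + 1 = a - b + 1 + 1 by ring,
    show 2 - (b - 1) = 3 - b by ring]
  rw [show 1 - (b - 1) = 2 - b by ring, show a - (b - 1) + 1 = a - b + 1 + 1 by ring] at e1'
  have e3 : ((-(Real.Gamma (b - 1) / Real.Gamma a / (2 - b)) : ℝ) : ℂ) =
      -(((Real.Gamma (b - 1) / Real.Gamma a : ℝ) : ℂ) / (2 - b)) := by push_cast; ring
  rw [e3]
  linear_combination kummerM a (b - 1) z * e1'

theorem hasDerivAt_tricomiFormula (a b : ℝ) {z : ℂ} (hb : ∀ n : ℤ, (n : ℝ) ≠ b)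
    (hc : 0 < a - b + 1) (hz : z ∈ Complex.slitPlane) :
    HasDerivAt (tricomiFormula a b)
      (((1 - b) * tricomiFormula a b z - (a - b + 1 : ℝ) * tricomiFormula a (b - 1) z) / z) z := by
  have h1 := (hasDerivAt_kummerM_system hb a (Complex.slitPlane_ne_zero hz)).const_mul
    ((Real.Gamma (1 - b) / Real.Gamma (a - b + 1) : ℝ) : ℂ)
  have h2 := (hasDerivAt_cpow_mul_kummerM b (a - b + 1) hz).const_mul
    ((Real.Gamma (b - 1) / Real.Gamma a : ℝ) : ℂ)
  have h3 : tricomiFormula a b = fun z =>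
      ((Real.Gamma (1 - b) / Real.Gamma (a - b + 1) : ℝ) : ℂ) * kummerM a b z +
      ((Real.Gamma (b - 1) / Real.Gamma a : ℝ) : ℂ) *
        (z ^ ((1 - b : ℝ) : ℂ) * kummerM (a - b + 1) (2 - b) z) := by
    ext z; unfold tricomiFormula; ring
  rw [tricomiFormula_pred a b hb hc, h3]
  refine (h1.add h2).congr_deriv ?_
  simp only
  rw [← mul_div_assoc, ← mul_div_assoc, ← add_div]
  congr 1
  ring

/-! ### Identification of the formula with the moment for `0 < b < 1` -/

theorem tendsto_ofReal_cpow_zero {r : ℝ} (hr : 0 < r) :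
    Tendsto (fun x : ℝ => (x : ℂ) ^ (r : ℂ)) (𝓝[>] 0) (𝓝 0) := by
  have h : Tendsto (fun x : ℝ => x ^ r) (𝓝[>] 0) (𝓝 0) := by
    have := (Real.continuousAt_rpow_const 0 r (Or.inr hr.le)).tendsto
    rw [Real.zero_rpow hr.ne'] at this
    exact this.mono_left nhdsWithin_le_nhds
  have h2 := (Complex.continuous_ofReal.tendsto _).comp h
  rw [Complex.ofReal_zero] at h2
  refine h2.congr' ?_
  filter_upwards [self_mem_nhdsWithin] with x (hx : 0 < x)
  exact Complex.ofReal_cpow hx.le r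

theorem tendsto_kummerM_zero (a b : ℝ) :
    Tendsto (fun x : ℝ => kummerM a b x) (𝓝[>] 0) (𝓝 1) := by
  have h : Continuous fun x : ℝ => kummerM a b x :=
    (continuous_kummerM a b).comp Complex.continuous_ofReal
  have := (h.tendsto 0).mono_left (nhdsWithin_le_nhds (s := Ioi 0))
  rwa [Complex.ofReal_zero, kummerM_zero] at this

theorem tendsto_ofReal_zero : Tendsto (fun x : ℝ => (x : ℂ)) (𝓝[>] 0) (𝓝 0) := by
  have := (Complex.continuous_ofReal.tendsto 0).mono_left (nhdsWithin_le_nhds (s := Ioi 0))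
  rwa [Complex.ofReal_zero] at this

theorem tendsto_exp_neg_zero : Tendsto (fun x : ℝ => Complex.exp (-x)) (𝓝[>] 0) (𝓝 1) := by
  have := (Complex.continuous_exp.tendsto _).comp tendsto_ofReal_zero.neg
  rwa [neg_zero, Complex.exp_zero] at this

/-- No exception at the poles: for `a = 0` both sides vanish because `Γ(0)` is `0` by convention. -/
theorem Real.div_Gamma_add_one (a : ℝ) : a / Real.Gamma (a + 1) = 1 / Real.Gamma a := by
  rcases eq_or_ne a 0 with rfl | ha
  · simp
  · rw [Real.Gamma_add_one ha]
    field_simp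

/-- The integral representation for `0 < b < 1`, in which case both sides are determined by
their behaviour at the origin. -/
theorem tricomiFormula_eq_gammaMoment_of_mem_Ioo {a b : ℝ} (hb0 : 0 < b) (hb1 : b < 1)
    (hc : 0 < a - b + 1) {z : ℂ} (hz : z ∈ Complex.slitPlane) :
    tricomiFormula a b z = gammaMoment (-a) (a - b + 1) z := by
  have hb : ∀ n : ℤ, (n : ℝ) ≠ b := by
    intro n hn
    rw [← hn] at hb0 hb1
    have h1 : 0 < n := by exact_mod_cast hb0
    have h2 : n < 1 := by exact_mod_cast hb1
    omega
  obtain ⟨c, hcdef⟩ : ∃ c, a - b + 1 = c := ⟨_, rfl⟩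
  rw [hcdef] at hc ⊢
  have hcC : (c : ℂ) = a - b + 1 := by rw [← hcdef]; push_cast; ring
  have hc0 : (c : ℂ) ≠ 0 := by exact_mod_cast hc.ne'
  set u₁ : ℂ → ℂ := kummerM a b with hu₁
  set v₁ : ℂ → ℂ := fun z => (1 - b) * kummerM a (b - 1) z / c with hv₁
  set u₂ : ℂ → ℂ := fun z => z ^ ((1 - b : ℝ) : ℂ) * kummerM c (2 - b) z with hu₂
  set v₂ : ℂ → ℂ := fun z => -(z ^ ((2 - b : ℝ) : ℂ) * kummerM (c + 1) (3 - b) z) / (2 - b) with hv₂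
  set A : ℂ := ((Real.Gamma (1 - b) / Real.Gamma c : ℝ) : ℂ) with hA
  set B : ℂ := ((Real.Gamma (b - 1) / Real.Gamma a : ℝ) : ℂ) with hB
  -- `(E, V)` is the moment solution minus the combination in the formula for `U`. It solves the
  -- same system, and `E = 0` is to be shown.
  set E : ℂ → ℂ := fun z => gammaMoment (-a) c z - A * u₁ z - B * u₂ z with hE
  set V : ℂ → ℂ := fun z => gammaMoment (-a) (c + 1) z - A * v₁ z - B * v₂ z with hV
  have hb2 : (2 : ℂ) - b ≠ 0 := by
    have : (2 : ℝ) - b ≠ 0 := by linarith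
    exact_mod_cast this
  -- the differential system for the three pairs
  have du₁ : ∀ z ∈ Complex.slitPlane, HasDerivAt u₁ (((1 - b) * u₁ z - c * v₁ z) / z) z := by
    intro z hz
    refine (hasDerivAt_kummerM_system hb a (Complex.slitPlane_ne_zero hz)).congr_deriv ?_
    simp only [hv₁]
    congr 2
    field_simp
  have dv₁ : ∀ z ∈ Complex.slitPlane, HasDerivAt v₁ (v₁ z - u₁ z) z := by
    intro z hz
    refine ((hasDerivAt_kummerM_pred hb a z).div_const (c : ℂ)).congr_deriv ?_
    simp only [hv₁, hu₁]
    rw [← hcC]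
    field_simp
  have du₂ : ∀ z ∈ Complex.slitPlane, HasDerivAt u₂ (((1 - b) * u₂ z - c * v₂ z) / z) z := by
    intro z hz
    refine (hasDerivAt_cpow_mul_kummerM b c hz).congr_deriv ?_
    simp only [hv₂, hu₂]
    congr 1
    field_simp
    ring
  have dv₂ : ∀ z ∈ Complex.slitPlane, HasDerivAt v₂ (v₂ z - u₂ z) z := fun z hz =>
    hasDerivAt_cpow_mul_kummerM_succ hb c hz
  have dE : ∀ z ∈ Complex.slitPlane, HasDerivAt E (((1 - b) * E z - c * V z) / z) z := by
    intro z hz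
    have hz0 := Complex.slitPlane_ne_zero hz
    refine (((hasDerivAt_gammaMoment hz (-a) hc).sub ((du₁ z hz).const_mul A)).sub
      ((du₂ z hz).const_mul B)).congr_deriv ?_
    have := mul_deriv_gammaMoment hz (-a) hc
    push_cast at this ⊢
    simp only [hE, hV]
    field_simp
    linear_combination this + (gammaMoment (-a) c z) * hcC
  have dV : ∀ z ∈ Complex.slitPlane, HasDerivAt V (V z - E z) z := by
    intro z hz
    refine (((hasDerivAt_gammaMoment hz (-a) (c := c + 1) (by linarith)).sub
      ((dv₁ z hz).const_mul A)).sub ((dv₂ z hz).const_mul B)).congr_deriv ?_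
    have := gammaMoment_succ_sub hz (-a) hc
    simp only [hE, hV]
    linear_combination this
  -- limits at the origin
  have lu₁ : Tendsto (fun x : ℝ => u₁ x) (𝓝[>] 0) (𝓝 1) := tendsto_kummerM_zero a b
  have lv₁ : Tendsto (fun x : ℝ => v₁ x) (𝓝[>] 0) (𝓝 ((1 - b) / c)) := by
    simpa using ((tendsto_kummerM_zero a (b - 1)).const_mul (1 - (b : ℂ))).div_const (c : ℂ)
  have lu₂ : Tendsto (fun x : ℝ => u₂ x) (𝓝[>] 0) (𝓝 0) := by
    have h := (tendsto_ofReal_cpow_zero (show 0 < 1 - b by linarith)).mul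
      (tendsto_kummerM_zero c (2 - b))
    rwa [zero_mul] at h
  have lv₂ : Tendsto (fun x : ℝ => v₂ x) (𝓝[>] 0) (𝓝 0) := by
    have h := (((tendsto_ofReal_cpow_zero (show 0 < 2 - b by linarith)).mul
      (tendsto_kummerM_zero (c + 1) (3 - b))).neg).div_const (2 - (b : ℂ))
    rwa [zero_mul, neg_zero, zero_div] at h
  have lE : Tendsto (fun x : ℝ => E x) (𝓝[>] 0) (𝓝 0) := by
    have h := tendsto_gammaMoment_zero hc (p := -a) (by linarith)
    rw [show c + -a = 1 - b by linarith] at h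
    have h2 := (h.sub (lu₁.const_mul A)).sub (lu₂.const_mul B)
    rwa [mul_one, mul_zero, sub_zero, sub_self] at h2
  have lV : Tendsto (fun x : ℝ => V x) (𝓝[>] 0) (𝓝 0) := by
    have h := tendsto_gammaMoment_zero (c := c + 1) (by linarith) (p := -a) (by linarith)
    have h2 := (h.sub (lv₁.const_mul A)).sub (lv₂.const_mul B)
    convert h2 using 2
    rw [hA, show c + 1 + -a = (1 - b) + 1 by linarith, Real.Gamma_add_one (by linarith),
      Real.Gamma_add_one hc.ne']
    push_cast
    field_simp
    ring
  have hcpow : ∀ x : ℝ, 0 < x → (x : ℂ) ^ ((b : ℂ) - 1) * (x : ℂ) ^ ((1 - b : ℝ) : ℂ) = 1 := by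
    intro x hx
    have hx0 : (x : ℂ) ≠ 0 := by exact_mod_cast hx.ne'
    rw [← Complex.cpow_add _ _ hx0]
    push_cast
    simp
  have hcpow2 : ∀ x : ℝ, 0 < x → (x : ℂ) ^ ((2 - b : ℝ) : ℂ) = (x : ℂ) ^ ((1 - b : ℝ) : ℂ) * x := by
    intro x hx
    have hx0 : (x : ℂ) ≠ 0 := by exact_mod_cast hx.ne'
    nth_rewrite 3 [← Complex.cpow_one (x : ℂ)]
    rw [← Complex.cpow_add _ _ hx0]
    push_cast
    congr 1; ring
  have hcpow3 : ∀ x : ℝ, 0 < x → (x : ℂ) ^ ((b : ℂ) - 1) * x = (x : ℂ) ^ (b : ℂ) := by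
    intro x hx
    have hx0 : (x : ℂ) ≠ 0 := by exact_mod_cast hx.ne'
    rw [Complex.cpow_sub _ _ hx0, Complex.cpow_one, div_mul_cancel₀ _ hx0]
  -- By the first equation this quantity is `x^b u₁'(x)`; the same weighted derivative is then
  -- evaluated for `u₂`, the moment and `E`.
  have lw₁ : Tendsto (fun x : ℝ => (x : ℂ) ^ ((b : ℂ) - 1) * ((1 - b) * u₁ x - c * v₁ x)) (𝓝[>] 0)
      (𝓝 0) := by
    have h := (tendsto_ofReal_cpow_zero hb0).mul
      ((tendsto_kummerM_zero (a + 1) (b + 1)).const_mul ((a / b : ℝ) : ℂ))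
    rw [zero_mul] at h
    refine h.congr' ?_
    filter_upwards [self_mem_nhdsWithin] with x (hx : 0 < x)
    have hx0 : (x : ℂ) ∈ Complex.slitPlane := Complex.ofReal_mem_slitPlane.2 hx
    have h1 := (du₁ x hx0).unique (hasDerivAt_kummerM a b x)
    rw [div_eq_iff (Complex.slitPlane_ne_zero hx0)] at h1
    rw [h1, ← hcpow3 x hx]
    ring
  have lw₂ : Tendsto (fun x : ℝ => (x : ℂ) ^ ((b : ℂ) - 1) * ((1 - b) * u₂ x - c * v₂ x)) (𝓝[>] 0)
      (𝓝 (1 - b)) := by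
    have h := ((tendsto_kummerM_zero c (2 - b)).const_mul (1 - (b : ℂ))).add
      ((tendsto_ofReal_zero.mul (tendsto_kummerM_zero (c + 1) (3 - b))).const_mul
        ((c : ℂ) / (2 - b)))
    simp only [mul_one, mul_zero, add_zero] at h
    refine h.congr' ?_
    filter_upwards [self_mem_nhdsWithin] with x (hx : 0 < x)
    simp only [hu₂, hv₂]
    rw [hcpow2 x hx]
    linear_combination (-((1 - b) * kummerM c (2 - b) x + c / (2 - b) *
      (x * kummerM (c + 1) (3 - b) x))) * hcpow x hx
  have lwG : Tendsto (fun x : ℝ => (x : ℂ) ^ ((b : ℂ) - 1) *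
      ((1 - b) * gammaMoment (-a) c x - c * gammaMoment (-a) (c + 1) x)) (𝓝[>] 0)
      (𝓝 ((-a : ℂ) * ((Real.Gamma b / Real.Gamma (b + c) : ℝ) : ℂ))) := by
    refine ((tendsto_rpow_mul_gammaMoment_zero hb0 hc).const_mul (-a : ℂ)).congr' ?_
    filter_upwards [self_mem_nhdsWithin] with x (hx : 0 < x)
    have hx0 : (x : ℂ) ∈ Complex.slitPlane := Complex.ofReal_mem_slitPlane.2 hx
    have h1 := mul_deriv_gammaMoment hx0 (-a) hc
    rw [show -a - 1 = -(b + c) by linarith] at h1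
    rw [Complex.ofReal_cpow hx.le, ← hcpow3 x hx]
    push_cast at h1 ⊢
    linear_combination (x : ℂ) ^ ((b : ℂ) - 1) * h1 +
      (x : ℂ) ^ ((b : ℂ) - 1) * gammaMoment (-a) c x * hcC
  have lw : Tendsto (fun x : ℝ => (x : ℂ) ^ ((b : ℂ) - 1) * ((1 - b) * E x - c * V x)) (𝓝[>] 0)
      (𝓝 0) := by
    have h := (lwG.sub (lw₁.const_mul A)).sub (lw₂.const_mul B)
    -- The constant `B` is matched here, through `b + c = a + 1` and `Γ(b) = (b-1) Γ(b-1)`; `A` was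
    -- matched by the limit of `E`.
    have e : (-a : ℂ) * ((Real.Gamma b / Real.Gamma (b + c) : ℝ) : ℂ) - A * 0 - B * (1 - b) = 0 := by
      have e1 : -a * (Real.Gamma b / Real.Gamma (b + c)) -
          Real.Gamma (b - 1) / Real.Gamma a * (1 - b) = 0 := by
        have h1 := Real.Gamma_add_one (show b - 1 ≠ 0 by linarith)
        rw [sub_add_cancel] at h1
        have h2 := Real.div_Gamma_add_one a
        rw [show b + c = a + 1 by linarith]
        rw [h1]
        linear_combination (-(b - 1) * Real.Gamma (b - 1)) * h2
      rw [hB]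
      have e2 : (((-a * (Real.Gamma b / Real.Gamma (b + c)) -
          Real.Gamma (b - 1) / Real.Gamma a * (1 - b) : ℝ)) : ℂ) = 0 := by rw [e1]; simp
      push_cast at e2 ⊢
      linear_combination e2
    rw [e] at h
    refine h.congr fun x => ?_
    simp only [hE, hV]
    ring
  -- the Wronskians
  have hconst : ∀ {W : ℂ → ℂ} {k l : ℂ}, (∀ z ∈ Complex.slitPlane, W z = k) →
      Tendsto (fun x : ℝ => W x) (𝓝[>] 0) (𝓝 l) → k = l := by
    intro W k l hW hl
    refine tendsto_nhds_unique ?_ hl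
    refine tendsto_const_nhds.congr' ?_
    filter_upwards [self_mem_nhdsWithin] with x (hx : 0 < x)
    exact (hW x (Complex.ofReal_mem_slitPlane.2 hx)).symm
  obtain ⟨k₁, hk₁⟩ := wronskian_const dE dV du₁ dv₁
  obtain ⟨k₂, hk₂⟩ := wronskian_const dE dV du₂ dv₂
  obtain ⟨k₃, hk₃⟩ := wronskian_const du₁ dv₁ du₂ dv₂
  have lb₂ : Tendsto (fun x : ℝ => (x : ℂ) ^ ((b : ℂ) - 1) * u₂ x) (𝓝[>] 0) (𝓝 1) := by
    refine (tendsto_kummerM_zero c (2 - b)).congr' ?_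
    filter_upwards [self_mem_nhdsWithin] with x (hx : 0 < x)
    simp only [hu₂]
    linear_combination (-kummerM c (2 - b) x) * hcpow x hx
  have lc₂ : Tendsto (fun x : ℝ => (x : ℂ) ^ ((b : ℂ) - 1) * v₂ x) (𝓝[>] 0) (𝓝 0) := by
    have h := ((tendsto_ofReal_zero.mul (tendsto_kummerM_zero (c + 1) (3 - b))).neg).div_const
      (2 - (b : ℂ))
    simp only [zero_mul, neg_zero, zero_div] at h
    refine h.congr' ?_
    filter_upwards [self_mem_nhdsWithin] with x (hx : 0 < x)
    simp only [hv₂]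
    rw [hcpow2 x hx]
    linear_combination (x * kummerM (c + 1) (3 - b) x / (2 - b)) * hcpow x hx
  have hk₁0 : k₁ = 0 := by
    refine hconst hk₁ ?_
    -- The weight `x^(b-1)` blows up, so `E v₁ - u₁ V` is rewritten as `(u₁ ((1-b) E - c V) - E
    -- ((1-b) u₁ - c v₁)) / c`, whose weighted terms have known limits.
    have h := ((((lu₁.mul lw).sub (lw₁.mul lE)).div_const (c : ℂ))).mul tendsto_exp_neg_zero
    simp only [mul_zero, sub_zero, zero_div, zero_mul] at h
    refine h.congr fun x => ?_
    field_simp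
    ring
  have hk₂0 : k₂ = 0 := by
    refine hconst hk₂ ?_
    have h := ((lE.mul lc₂).sub (lb₂.mul lV)).mul tendsto_exp_neg_zero
    simp only [mul_zero, sub_zero, zero_mul] at h
    refine h.congr fun x => ?_
    ring
  have hk₃0 : k₃ = -((1 - b) / c) := by
    refine hconst hk₃ ?_
    have h := ((lu₁.mul lc₂).sub (lb₂.mul lv₁)).mul tendsto_exp_neg_zero
    simp only [mul_zero, zero_sub, one_mul, mul_one] at h
    refine h.congr fun x => ?_
    ring
  have hk₃ne : k₃ ≠ 0 := by
    rw [hk₃0]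
    have : (1 : ℝ) - b ≠ 0 := by linarith
    have h1 : (1 : ℂ) - b ≠ 0 := by exact_mod_cast this
    exact neg_ne_zero.2 (div_ne_zero h1 hc0)
  have hz0 := Complex.slitPlane_ne_zero hz
  have g1 := hk₁ z hz
  have g2 := hk₂ z hz
  have g3 := hk₃ z hz
  rw [hk₁0] at g1
  rw [hk₂0] at g2
  have hE0 : E z = 0 := by
    -- `V` is eliminated: `E (u₁ v₂ - u₂ v₁) = u₁ (E v₂ - u₂ V) - u₂ (E v₁ - u₁ V)`.
    have : E z * k₃ = 0 := by
      rw [← g3]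
      linear_combination u₁ z * g2 - u₂ z * g1
    exact (mul_eq_zero.1 this).resolve_right hk₃ne
  simp only [hE] at hE0
  unfold tricomiFormula
  rw [hcdef, mul_assoc]
  linear_combination -hE0

/-! ### Extension of the representation to the remaining `b` -/

theorem tricomiFormula_add_one_add_one (a b : ℝ) {z : ℂ} (hb : ∀ n : ℤ, (n : ℝ) ≠ b)
    (hc : 0 < a - b + 1) (hz : z ≠ 0) :
    tricomiFormula a b z = z * tricomiFormula (a + 1) (b + 1) z +
      ((a - b + 1 : ℝ) : ℂ) * tricomiFormula (a + 1) b z := by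
  have hb2 : ∀ n : ℤ, (n : ℝ) ≠ 2 - b := fun n hn => hb (2 - n) (by push_cast; linarith)
  have hb0 : b ≠ 0 := fun h => hb 0 (by simp [h])
  have hb0' : (b : ℂ) ≠ 0 := by exact_mod_cast hb0
  have hb1 : b - 1 ≠ 0 := fun h => hb 1 (by push_cast; linarith)
  have hG := (Real.Gamma_pos_of_pos hc).ne'
  obtain ⟨c, hcdef⟩ : ∃ c, a - b + 1 = c := ⟨_, rfl⟩
  unfold tricomiFormula
  rw [show a + 1 - (b + 1) + 1 = a - b + 1 by ring, show a + 1 - b + 1 = a - b + 1 + 1 by ring,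
    show 1 - (b + 1) = -b by ring, show b + 1 - 1 = b by ring, show 2 - (b + 1) = 2 - b - 1 by ring,
    hcdef]
  rw [hcdef] at hc hG
  have e1 : Real.Gamma (1 - b) / Real.Gamma c = -b * (Real.Gamma (-b) / Real.Gamma c) := by
    rw [show 1 - b = -b + 1 by ring, Real.Gamma_add_one (neg_ne_zero.2 hb0)]; ring
  have e2 : c * (Real.Gamma (1 - b) / Real.Gamma (c + 1)) =
      -b * (Real.Gamma (-b) / Real.Gamma c) := by
    rw [show 1 - b = -b + 1 by ring, Real.Gamma_add_one (neg_ne_zero.2 hb0),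
      Real.Gamma_add_one hc.ne']
    field_simp
  have e3 : Real.Gamma (b - 1) / Real.Gamma a =
      a * (Real.Gamma (b - 1) / Real.Gamma (a + 1)) := by
    have := Real.div_Gamma_add_one a
    linear_combination (-Real.Gamma (b - 1)) * this
  have e4 : Real.Gamma b / Real.Gamma (a + 1) =
      (b - 1) * (Real.Gamma (b - 1) / Real.Gamma (a + 1)) := by
    have := Real.Gamma_add_one hb1
    rw [sub_add_cancel] at this
    rw [this]; ring
  have e2' : (c : ℂ) * ((Real.Gamma (1 - b) / Real.Gamma (c + 1) : ℝ) : ℂ) =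
      -b * ((Real.Gamma (-b) / Real.Gamma c : ℝ) : ℂ) := by exact_mod_cast e2
  rw [e1, e3, e4]
  have ha : (a : ℂ) = b + c - 1 := by rw [← hcdef]; push_cast; ring
  have hpow : z * z ^ ((-b : ℝ) : ℂ) = z ^ ((1 - b : ℝ) : ℂ) := by
    nth_rewrite 1 [← Complex.cpow_one z]
    rw [← Complex.cpow_add _ _ hz]
    push_cast; congr 1
  have r4 := kummerM_succ_left hb a z
  have r4' := kummerM_succ_left hb2 c z
  have r1 := mul_deriv_kummerM hb2 c z
  have hne : (2 : ℂ) - b ≠ 0 := by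
    have : 2 - b ≠ 0 := fun h => hb2 0 (by simp [h])
    exact_mod_cast this
  rw [r4]
  rw [show 2 - b + 1 = 3 - b by ring] at r1 r4'
  push_cast at r1 r4' hpow ⊢
  set g₁ : ℂ := (Real.Gamma (-b) : ℂ) / Real.Gamma c
  set g₂ : ℂ := (Real.Gamma (b - 1) : ℂ) / Real.Gamma (a + 1)
  have s2 : (a : ℂ) * kummerM c (2 - b) z = (b - 1) * kummerM c (2 - b - 1) z +
      c * kummerM (c + 1) (2 - b) z := by
    rw [r4', ha]
    linear_combination -r1
  have t1 : z / b * kummerM (a + 1) (b + 1) z * b = z * kummerM (a + 1) (b + 1) z := by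
    field_simp
  push_cast at e2'
  linear_combination (-(kummerM a b z + z / b * kummerM (a + 1) (b + 1) z)) * e2' +
    g₁ * t1 + g₂ * z ^ (1 - b : ℂ) * s2 - g₂ * (b - 1) * kummerM c (2 - b - 1) z * hpow

/-- If the integral representation holds for `(a, b)`, it holds for `(a, b - 1)`. -/
theorem tricomiFormula_eq_gammaMoment_pred {a b : ℝ} (hb : ∀ n : ℤ, (n : ℝ) ≠ b)
    (hc : 0 < a - b + 1)
    (h : ∀ z ∈ Complex.slitPlane, tricomiFormula a b z = gammaMoment (-a) (a - b + 1) z)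
    {z : ℂ} (hz : z ∈ Complex.slitPlane) :
    tricomiFormula a (b - 1) z = gammaMoment (-a) (a - b + 1 + 1) z := by
  have h1 := hasDerivAt_tricomiFormula a b hb hc hz
  have h2 := hasDerivAt_gammaMoment hz (-a) hc
  have heq : tricomiFormula a b =ᶠ[𝓝 z] gammaMoment (-a) (a - b + 1) :=
    (Complex.isOpen_slitPlane.eventually_mem hz).mono h
  have h3 := h1.unique (h2.congr_of_eventuallyEq heq)
  rw [div_eq_iff (Complex.slitPlane_ne_zero hz), h z hz] at h3
  have h4 := mul_deriv_gammaMoment hz (-a) hc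
  have hc0 : ((a - b + 1 : ℝ) : ℂ) ≠ 0 := by exact_mod_cast hc.ne'
  refine mul_left_cancel₀ hc0 ?_
  push_cast at h3 h4 ⊢
  linear_combination -h3 - h4

/-- Induction on a bound `-n < b`. Passing to `(a+1, b+1)` keeps `c` fixed and raises `b`; from
there the representation descends to `(a+1, b)`, and matching contiguous relations on both sides
give `(a, b)`. -/
theorem tricomiFormula_eq_gammaMoment {a b : ℝ} (hb : ∀ n : ℤ, (n : ℝ) ≠ b) (hb1 : b < 1)
    (hc : 0 < a - b + 1) {z : ℂ} (hz : z ∈ Complex.slitPlane) :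
    tricomiFormula a b z = gammaMoment (-a) (a - b + 1) z := by
  obtain ⟨n, hn⟩ : ∃ n : ℕ, -(n : ℝ) < b := by
    obtain ⟨n, hn⟩ := exists_nat_gt (-b)
    exact ⟨n, by linarith⟩
  induction n generalizing a b z with
  | zero => exact tricomiFormula_eq_gammaMoment_of_mem_Ioo (by simpa using hn) hb1 hc hz
  | succ n ih =>
    by_cases h0 : 0 < b
    · exact tricomiFormula_eq_gammaMoment_of_mem_Ioo h0 hb1 hc hz
    have hb' : b < 0 := lt_of_le_of_ne (not_lt.1 h0) fun h => hb 0 (by simp [h])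
    have hbs : ∀ n : ℤ, (n : ℝ) ≠ b + 1 := fun n hn => hb (n - 1) (by push_cast; linarith)
    have hcs : 0 < a + 1 - (b + 1) + 1 := by linarith
    have h1 : ∀ z ∈ Complex.slitPlane,
        tricomiFormula (a + 1) (b + 1) z = gammaMoment (-(a + 1)) (a + 1 - (b + 1) + 1) z :=
      fun z hz => ih hbs (by linarith) hcs hz (by push_cast at hn; linarith)
    have h2 := tricomiFormula_eq_gammaMoment_pred hbs hcs h1 hz
    have h3 := gammaMoment_eq_add hz (-a) hc
    rw [tricomiFormula_add_one_add_one a b hb hc (Complex.slitPlane_ne_zero hz), h1 z hz, h3]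
    rw [add_sub_cancel_right] at h2
    rw [h2, show -(a + 1) = -a - 1 by ring, show a + 1 - (b + 1) + 1 = a - b + 1 by ring]

/-- The substitution `(a, b) ↦ (a-b+1, 2-b)` exchanges the two summands up to the power of `z`. -/
theorem tricomiFormula_kummer_transformation (a b : ℝ) {z : ℂ} (hz : z ≠ 0) :
    tricomiFormula a b z = z ^ ((1 - b : ℝ) : ℂ) * tricomiFormula (a - b + 1) (2 - b) z := by
  unfold tricomiFormula
  rw [show 1 - (2 - b) = b - 1 by ring, show a - b + 1 - (2 - b) + 1 = a by ring,
    show 2 - b - 1 = 1 - b by ring, show 2 - (2 - b) = b by ring]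
  have h : z ^ ((1 - b : ℝ) : ℂ) * z ^ ((b - 1 : ℝ) : ℂ) = 1 := by
    rw [← Complex.cpow_add _ _ hz]
    push_cast
    simp
  linear_combination (-((Real.Gamma (1 - b) / Real.Gamma (a - b + 1) : ℝ) : ℂ) *
    kummerM a b z) * h

theorem tricomiFormula_eq_cpow_mul_gammaMoment {a b : ℝ} (hb : ∀ n : ℤ, (n : ℝ) ≠ b) (hb1 : 1 < b)
    (ha : 0 < a) {z : ℂ} (hz : z ∈ Complex.slitPlane) :
    tricomiFormula a b z = z ^ ((1 - b : ℝ) : ℂ) * gammaMoment (-(a - b + 1)) a z := by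
  have hb2 : ∀ n : ℤ, (n : ℝ) ≠ 2 - b := fun n hn => hb (2 - n) (by push_cast; linarith)
  rw [tricomiFormula_kummer_transformation a b (Complex.slitPlane_ne_zero hz),
    tricomiFormula_eq_gammaMoment hb2 (by linarith) (by linarith) hz]
  congr 2
  ring

theorem eventually_forall_intCast_ne (b : ℝ) (hb : ∃ n : ℤ, (n : ℝ) = b) :
    ∀ᶠ β in 𝓝[≠] b, ∀ n : ℤ, (n : ℝ) ≠ β := by
  obtain ⟨k, rfl⟩ := hb
  have h1 : Ioo ((k : ℝ) - 1) (k + 1) ∈ 𝓝 (k : ℝ) := Ioo_mem_nhds (by linarith) (by linarith)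
  filter_upwards [nhdsWithin_le_nhds h1, self_mem_nhdsWithin] with β hβ hne n hn
  rw [← hn] at hβ hne
  have a1 : k - 1 < n := by exact_mod_cast hβ.1
  have a2 : n < k + 1 := by exact_mod_cast hβ.2
  exact hne (by rw [show n = k by omega]; rfl)

theorem tricomiU_eq_gammaMoment {a b : ℝ} (hb1 : b < 1) (hc : 0 < a - b + 1) {z : ℂ}
    (hz : z ∈ Complex.slitPlane) : tricomiU a b z = gammaMoment (-a) (a - b + 1) z := by
  unfold tricomiU
  split_ifs with hb
  · refine Tendsto.limUnder_eq ?_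
    have hC : Tendsto (fun β : ℝ => a - β + 1) (𝓝[≠] b) (𝓝 (a - b + 1)) :=
      (Continuous.tendsto (by fun_prop) b).mono_left nhdsWithin_le_nhds
    refine (tendsto_gammaMoment_param hz hc tendsto_const_nhds hC).congr' ?_
    filter_upwards [eventually_forall_intCast_ne b hb, nhdsWithin_le_nhds (Iio_mem_nhds hb1),
      hC.eventually (lt_mem_nhds hc)] with β h1 h2 h3
    exact (tricomiFormula_eq_gammaMoment h1 h2 h3 hz).symm
  · exact tricomiFormula_eq_gammaMoment (not_exists.1 hb) hb1 hc hz

theorem tricomiU_eq_cpow_mul_gammaMoment {a b : ℝ} (hb1 : 1 ≤ b) (ha : 0 < a) {z : ℂ}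
    (hz : z ∈ Complex.slitPlane) :
    tricomiU a b z = z ^ ((1 - b : ℝ) : ℂ) * gammaMoment (-(a - b + 1)) a z := by
  have hz0 := Complex.slitPlane_ne_zero hz
  unfold tricomiU
  split_ifs with hb
  · refine Tendsto.limUnder_eq ?_
    have hne := eventually_forall_intCast_ne b hb
    have hlim : ∀ {l : Filter ℝ} [l.IsCountablyGenerated], l ≤ 𝓝[≠] b → (∀ᶠ β in l, 1 < β) →
        Tendsto (fun β => tricomiFormula a β z) l
          (𝓝 (z ^ ((1 - b : ℝ) : ℂ) * gammaMoment (-(a - b + 1)) a z)) := by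
      intro l _ hl hl1
      have hP : Tendsto (fun β : ℝ => -(a - β + 1)) l (𝓝 (-(a - b + 1))) :=
        (Continuous.tendsto (by fun_prop) b).mono_left (hl.trans nhdsWithin_le_nhds)
      have hQ : Tendsto (fun β : ℝ => z ^ ((1 - β : ℝ) : ℂ)) l (𝓝 (z ^ ((1 - b : ℝ) : ℂ))) := by
        have : Continuous fun β : ℝ => z ^ ((1 - β : ℝ) : ℂ) :=
          Continuous.const_cpow (by fun_prop) (Or.inl hz0)
        exact (this.tendsto b).mono_left (hl.trans nhdsWithin_le_nhds)
      refine (hQ.mul (tendsto_gammaMoment_param hz ha hP tendsto_const_nhds)).congr' ?_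
      filter_upwards [hl1, hl hne] with β h1 h2
      exact (tricomiFormula_eq_cpow_mul_gammaMoment h2 h1 ha hz).symm
    -- At `b = 1` the two representations meet: `β < 1` uses the plain moment, `β > 1` the
    -- transformed one, and their limits agree.
    rcases hb1.eq_or_lt with rfl | hb1
    · rw [← nhdsLT_sup_nhdsGT]
      refine Tendsto.sup ?_ (hlim (nhdsGT_le_nhdsNE 1) self_mem_nhdsWithin)
      have hC : Tendsto (fun β : ℝ => a - β + 1) (𝓝[<] 1) (𝓝 (a - 1 + 1)) :=
        (Continuous.tendsto (by fun_prop) 1).mono_left nhdsWithin_le_nhds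
      rw [sub_self, Complex.ofReal_zero, Complex.cpow_zero, one_mul]
      rw [sub_add_cancel] at hC ⊢
      refine (tendsto_gammaMoment_param hz ha tendsto_const_nhds hC).congr' ?_
      filter_upwards [self_mem_nhdsWithin, nhdsLT_le_nhdsNE 1 hne,
        hC.eventually (lt_mem_nhds ha)] with β h1 h2 h3
      exact (tricomiFormula_eq_gammaMoment h2 h1 h3 hz).symm
    · exact hlim le_rfl (nhdsWithin_le_nhds (Ioi_mem_nhds hb1))
  · exact tricomiFormula_eq_cpow_mul_gammaMoment (not_exists.1 hb)
      (lt_of_le_of_ne hb1 fun h => hb ⟨1, by simpa using h⟩) ha hz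

/-! ### Counting zeros by the change of argument -/

/-- Dividing out finitely many zeros of finite order. -/
theorem exists_eq_prod_mul {f : ℂ → ℂ} (Z : Finset ℂ) (hf : ∀ u ∈ Z, AnalyticAt ℂ f u)
    (hord : ∀ u ∈ Z, analyticOrderAt f u ≠ ⊤) :
    ∃ g : ℂ → ℂ, (∀ u ∈ Z, AnalyticAt ℂ g u ∧ g u ≠ 0) ∧
      ∀ z ∉ Z, g z = f z / ∏ u ∈ Z, (z - u) ^ analyticOrderNatAt f u := by
  classical
  have H : ∀ u ∈ Z, ∃ h : ℂ → ℂ, AnalyticAt ℂ h u ∧ h u ≠ 0 ∧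
      ∀ᶠ z in 𝓝 u, f z = (z - u) ^ analyticOrderNatAt f u * h z := by
    intro u hu
    have := ((hf u hu).analyticOrderAt_eq_natCast (n := analyticOrderNatAt f u)).1
      (Nat.cast_analyticOrderNatAt (hord u hu)).symm
    simpa only [smul_eq_mul] using this
  choose! h hh using H
  -- `F u` is the quotient near `u` after cancelling the power of `z - u`; it supplies the value at
  -- `u`.
  set F : ℂ → ℂ → ℂ := fun u z => h u z / ∏ v ∈ Z.erase u, (z - v) ^ analyticOrderNatAt f v with hF
  have hne : ∀ u ∈ Z, ∏ v ∈ Z.erase u, (u - v) ^ analyticOrderNatAt f v ≠ 0 := by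
    intro u _
    refine Finset.prod_ne_zero_iff.2 fun v hv => pow_ne_zero _ (sub_ne_zero.2 ?_)
    exact (Finset.ne_of_mem_erase hv).symm
  refine ⟨fun z => if z ∈ Z then F z z else f z / ∏ u ∈ Z, (z - u) ^ analyticOrderNatAt f u,
    fun u hu => ⟨?_, ?_⟩, fun z hz => if_neg hz⟩
  · have hFa : AnalyticAt ℂ (F u) u := by
      refine (hh u hu).1.div ?_ (hne u hu)
      exact Finset.analyticAt_fun_prod _ fun v _ => by fun_prop
    refine hFa.congr ?_
    have hcl : ∀ᶠ z in 𝓝 u, z ∉ Z.erase u :=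
      (Z.erase u).finite_toSet.isClosed.isOpen_compl.eventually_mem (Finset.notMem_erase u Z)
    filter_upwards [hcl, (hh u hu).2.2] with z hz hfz
    by_cases hzu : z = u
    · subst hzu
      rw [if_pos hu]
    · have hzZ : z ∉ Z := fun h => hz (Finset.mem_erase.2 ⟨hzu, h⟩)
      rw [if_neg hzZ, ← Finset.mul_prod_erase _ _ hu, hfz, hF]
      have := pow_ne_zero (analyticOrderNatAt f u) (sub_ne_zero.2 hzu)
      exact (mul_div_mul_left _ _ this).symm
  · simp only [if_pos hu]
    exact div_ne_zero (hh u hu).2.1 (hne u hu)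

/-- If `h` is the nonvanishing local factor at `u`, then `conj ∘ h ∘ conj` is one at the conjugate
point. -/
theorem analyticOrderNatAt_conj {f : ℂ → ℂ} {u : ℂ} (hf : AnalyticAt ℂ f u)
    (hf' : AnalyticAt ℂ f (starRingEnd ℂ u)) (hord : analyticOrderAt f u ≠ ⊤)
    (hconj : ∀ᶠ z in 𝓝 u, f (starRingEnd ℂ z) = starRingEnd ℂ (f z)) :
    analyticOrderNatAt f (starRingEnd ℂ u) = analyticOrderNatAt f u := by
  obtain ⟨h, ha, h0, he⟩ := (hf.analyticOrderAt_eq_natCast (n := analyticOrderNatAt f u)).1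
    (Nat.cast_analyticOrderNatAt hord).symm
  have hc : Tendsto (starRingEnd ℂ) (𝓝 (starRingEnd ℂ u)) (𝓝 u) := by
    have := Complex.continuous_conj.tendsto (starRingEnd ℂ u)
    rwa [Complex.conj_conj] at this
  have key : analyticOrderAt f (starRingEnd ℂ u) = (analyticOrderNatAt f u : ℕ) := by
    refine (hf'.analyticOrderAt_eq_natCast).2
      ⟨fun z => starRingEnd ℂ (h (starRingEnd ℂ z)), ?_, ?_, ?_⟩
    · rw [Complex.analyticAt_iff_eventually_differentiableAt] at ha ⊢
      filter_upwards [hc.eventually ha] with z hz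
      have := hz.conj_conj
      rw [Complex.conj_conj] at this
      exact this
    · simpa using h0
    · filter_upwards [hc.eventually he, hc.eventually hconj] with z hz1 hz2
      rw [Complex.conj_conj] at hz2
      rw [hz2, hz1]
      simp
  rw [analyticOrderNatAt, key]
  simp

theorem eq_of_continuous_of_int_mul {X : Type*} [TopologicalSpace X] [PreconnectedSpace X]
    {φ : X → ℝ} (hφ : Continuous φ) {c : ℝ} (hc : c ≠ 0) (hint : ∀ x, ∃ n : ℤ, φ x = n * c)
    (x y : X) : φ x = φ y := by
  choose n hn using hint
  have hcont : Continuous n := by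
    rw [Int.isClosedEmbedding_coe_real.isEmbedding.continuous_iff]
    have : ((↑) : ℤ → ℝ) ∘ n = fun x => φ x / c := by
      ext x
      simp [hn x, hc]
    rw [this]
    exact hφ.div_const c
  rw [hn x, hn y, PreconnectedSpace.constant ‹_› hcont]

theorem exists_int_im_sub_arg {w z : ℂ} (h : Complex.exp w = z) :
    ∃ n : ℤ, w.im - z.arg = n * (2 * Real.pi) := by
  have hz : z ≠ 0 := h ▸ Complex.exp_ne_zero w
  have h1 : Complex.exp w = Complex.exp (Complex.log z) := by rw [h, Complex.exp_log hz]
  obtain ⟨n, hn⟩ := Complex.exp_eq_exp_iff_exists_int.1 h1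
  refine ⟨n, ?_⟩
  have := congrArg Complex.im hn
  simp [Complex.log_im] at this
  linarith

/-- If `G` is continuous and zero-free on the closed upper half-plane, avoids `(-∞, 0]` on the real
axis and is close to `z ^ q` on a large semicircle, then `q` is small. -/
theorem abs_mul_pi_le_of_continuousOn_upperHalfPlane {G : ℂ → ℂ}
    (hG : ContinuousOn G {z | 0 ≤ z.im})
    (hG0 : ∀ z : ℂ, 0 ≤ z.im → G z ≠ 0) (hreal : ∀ x : ℝ, G x ∈ Complex.slitPlane) {q R : ℝ}
    (hR : 0 < R)
    (harc : ∀ z : ℂ, 0 ≤ z.im → ‖z‖ = R → G z / z ^ (q : ℂ) ∈ Complex.slitPlane) :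
    |q| * Real.pi ≤ Real.pi + |(G (-R) / (-R : ℂ) ^ (q : ℂ)).arg| := by
  -- A retraction of the plane onto the closed upper half-plane: `G ∘ ρ` is continuous and zero-free
  -- on a simply connected open set, hence has a continuous logarithm `h`.
  set ρ : ℂ → ℂ := fun z => z.re + (max z.im 0 : ℝ) * Complex.I with hρ
  have hρc : Continuous ρ := by fun_prop
  have hρim : ∀ z, 0 ≤ (ρ z).im := by intro z; simp [hρ]
  have hρid : ∀ z : ℂ, 0 ≤ z.im → ρ z = z := by
    intro z hz
    simp only [hρ, max_eq_left hz]
    exact Complex.re_add_im z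
  have hGc : Continuous (G ∘ ρ) := hG.comp_continuous hρc hρim
  have hsc : IsSimplyConnected (univ : Set ℂ) := by
    have := (convex_univ (𝕜 := ℝ) (E := ℂ)).contractibleSpace univ_nonempty
    exact SimplyConnectedSpace.ofContractible _
  obtain ⟨h, hh, hexp⟩ := Complex.exists_continuousOn_eqOn_exp_comp (X := ℂ) (U := univ)
    (g := G ∘ ρ) hsc isOpen_univ hGc.continuousOn
    (by rintro ⟨z, -, hz⟩; exact hG0 _ (hρim z) hz)
  have hhc : Continuous h := continuousOn_univ.1 hh
  have hexp' : ∀ z : ℂ, 0 ≤ z.im → Complex.exp (h z) = G z := by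
    intro z hz
    have := hexp (mem_univ z)
    simpa [hρid z hz] using this
  have hpi := Real.pi_pos
  -- the real axis
  have hφ : Continuous fun x : ℝ => (h x).im - (G x).arg := by
    have h1 : Continuous fun x : ℝ => G x :=
      hG.comp_continuous Complex.continuous_ofReal (fun x => by simp)
    refine Continuous.sub (by fun_prop) (continuous_iff_continuousAt.2 fun x => ?_)
    exact (Complex.continuousAt_arg (hreal x)).comp (f := fun x : ℝ => G x) h1.continuousAt
  have hφc := eq_of_continuous_of_int_mul hφ (c := 2 * Real.pi) (by positivity)
    (fun x => exists_int_im_sub_arg (hexp' x (by simp))) R (-R)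
  -- the semicircle
  set w : Icc (0 : ℝ) Real.pi → ℂ := fun θ => Real.log R + (θ : ℝ) * Complex.I with hw
  have hwc : Continuous w := by fun_prop
  have hwexp : ∀ θ, Complex.exp (w θ) = R * Complex.exp ((θ : ℝ) * Complex.I) := by
    intro θ
    rw [hw, Complex.exp_add, ← Complex.ofReal_exp, Real.exp_log hR]
  have hwnorm : ∀ θ, ‖Complex.exp (w θ)‖ = R := by
    intro θ
    rw [hwexp, norm_mul, Complex.norm_exp_ofReal_mul_I, mul_one, Complex.norm_real,
      Real.norm_of_nonneg hR.le]
  have hwim : ∀ θ, 0 ≤ (Complex.exp (w θ)).im := by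
    intro θ
    rw [hwexp, Complex.im_ofReal_mul, Complex.exp_ofReal_mul_I_im]
    exact mul_nonneg hR.le (Real.sin_nonneg_of_mem_Icc θ.2)
  have hwlog : ∀ θ, Complex.log (Complex.exp (w θ)) = w θ := by
    intro θ
    refine Complex.log_exp ?_ ?_
    · have := θ.2.1; simp [hw]; linarith
    · have := θ.2.2; simpa [hw]
  have hcpow : ∀ θ, Complex.exp (w θ) ^ (q : ℂ) = Complex.exp (q * w θ) := by
    intro θ
    rw [Complex.cpow_def_of_ne_zero (Complex.exp_ne_zero _), hwlog, mul_comm]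
  have hψ : Continuous fun θ : Icc (0 : ℝ) Real.pi => (h (Complex.exp (w θ)) - q * w θ).im -
      (G (Complex.exp (w θ)) / Complex.exp (w θ) ^ (q : ℂ)).arg := by
    have h1 : Continuous fun θ => G (Complex.exp (w θ)) / Complex.exp (w θ) ^ (q : ℂ) := by
      simp_rw [hcpow]
      refine Continuous.div (hG.comp_continuous (by fun_prop) hwim) (by fun_prop)
        fun θ => Complex.exp_ne_zero _
    refine Continuous.sub (by fun_prop) (continuous_iff_continuousAt.2 fun θ => ?_)
    exact (Complex.continuousAt_arg (harc _ (hwim θ) (hwnorm θ))).comp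
      (f := fun θ => G (Complex.exp (w θ)) / Complex.exp (w θ) ^ (q : ℂ)) h1.continuousAt
  have : PreconnectedSpace (Icc (0 : ℝ) Real.pi) :=
    isPreconnected_iff_preconnectedSpace.1 isPreconnected_Icc
  have hψc := eq_of_continuous_of_int_mul hψ (c := 2 * Real.pi) (by positivity)
    (fun θ => exists_int_im_sub_arg (by rw [Complex.exp_sub, hexp' _ (hwim θ), hcpow]))
    ⟨0, left_mem_Icc.2 hpi.le⟩ ⟨Real.pi, right_mem_Icc.2 hpi.le⟩
  have e0 : Complex.exp (w ⟨0, left_mem_Icc.2 hpi.le⟩) = R := by rw [hwexp]; simp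
  have e1 : Complex.exp (w ⟨Real.pi, right_mem_Icc.2 hpi.le⟩) = -R := by
    rw [hwexp]; simp [Complex.exp_pi_mul_I]
  simp only [e0, e1] at hψc
  have i0 : (q * w ⟨0, left_mem_Icc.2 hpi.le⟩ : ℂ).im = 0 := by simp [hw]
  have i1 : (q * w ⟨Real.pi, right_mem_Icc.2 hpi.le⟩ : ℂ).im = q * Real.pi := by simp [hw]
  rw [Complex.sub_im, Complex.sub_im, i0, i1] at hψc
  have a0 : (G R / (R : ℂ) ^ (q : ℂ)).arg = (G R).arg := by
    rw [← Complex.ofReal_cpow hR.le, div_eq_mul_inv, ← Complex.ofReal_inv, mul_comm,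
      Complex.arg_real_mul _ (by positivity)]
  rw [a0] at hψc
  rw [Complex.ofReal_neg] at hφc
  -- The change of `Im h` from `R` to `-R` is computed along the axis and along the half circle; the
  -- terms at `R` cancel because `R^q > 0`.
  have hq : q * Real.pi = (G (-R)).arg - (G (-R) / (-R : ℂ) ^ (q : ℂ)).arg := by linarith
  calc |q| * Real.pi = |q * Real.pi| := by rw [abs_mul, abs_of_pos hpi]
    _ ≤ |(G (-R)).arg| + |(G (-R) / (-R : ℂ) ^ (q : ℂ)).arg| := by
        rw [hq]; exact abs_sub _ _
    _ ≤ _ := by gcongr; exact Complex.abs_arg_le_pi _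

/-- A filter statement at infinity in the closed upper half-plane, in terms of norms. -/
theorem exists_forall_of_eventually_upperHalfPlane {P : ℂ → Prop}
    (h : ∀ᶠ z in comap norm atTop ⊓ 𝓟 {z : ℂ | 0 ≤ z.im}, P z) :
    ∃ R : ℝ, 0 < R ∧ ∀ z : ℂ, 0 ≤ z.im → R ≤ ‖z‖ → P z := by
  rw [eventually_inf_principal, eventually_comap, eventually_atTop] at h
  obtain ⟨R, hR⟩ := h
  exact ⟨max R 1, by positivity, fun z hz hRz => hR ‖z‖ ((le_max_left _ _).trans hRz) z rfl hz⟩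

theorem tendsto_sub_div_self (u : ℂ) :
    Tendsto (fun z : ℂ => (z - u) / z) (comap norm atTop) (𝓝 1) := by
  have h1 : Tendsto (fun z : ℂ => 1 - u * z⁻¹) (comap norm atTop) (𝓝 (1 - u * 0)) := by
    rw [comap_norm_atTop]
    exact (tendsto_inv₀_cobounded.const_mul u).const_sub 1
  rw [mul_zero, sub_zero] at h1
  refine h1.congr' ?_
  have : ∀ᶠ z : ℂ in comap norm atTop, z ≠ 0 := by
    rw [eventually_comap]
    filter_upwards [eventually_gt_atTop 0] with r hr z hz
    rw [← hz] at hr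
    exact norm_pos_iff.1 hr
  filter_upwards [this] with z hz
  field_simp

/-- The zeros in the cut plane of a function which is real on the positive axis, extends continuously
to the closed upper half-plane with values off `(-∞, 0]` on the real axis, and grows like `z ^ p`. -/
theorem hasZeroCount_of_tendsto {f : ℂ → ℂ} (hf : AnalyticOnNhd ℂ f Complex.slitPlane)
    (hconj : ∀ z ∈ Complex.slitPlane, f (starRingEnd ℂ z) = starRingEnd ℂ (f z))
    (hcont : ContinuousOn f {z | 0 ≤ z.im}) (hreal : ∀ x : ℝ, f x ∈ Complex.slitPlane)
    {p : ℝ} {m : ℕ} (hp : |p - 2 * m| < 1)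
    (hlim : Tendsto (fun z => f z / z ^ (p : ℂ)) (comap norm atTop ⊓ 𝓟 {z : ℂ | 0 ≤ z.im}) (𝓝 1)) :
    HasZeroCount f Complex.slitPlane (2 * m) := by
  classical
  have him : ∀ z : ℂ, 0 < z.im → z ∈ Complex.slitPlane := fun z hz => Or.inr hz.ne'
  have hcslit : ∀ z ∈ Complex.slitPlane, starRingEnd ℂ z ∈ Complex.slitPlane := by
    intro z hz
    rcases hz with h | h
    · left; simpa
    · right; simpa
  have hre0 : ∀ z : ℂ, z.im = 0 → f z ≠ 0 := by
    intro z hz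
    have h := Complex.slitPlane_ne_zero (hreal z.re)
    rwa [show ((z.re : ℝ) : ℂ) = z from Complex.ext rfl (by simp [hz])] at h
  have h1S : (1 : ℂ) ∈ Complex.slitPlane := Complex.one_mem_slitPlane
  have hf1 : f 1 ≠ 0 := hre0 1 rfl
  -- finiteness
  obtain ⟨R₀, hR₀, hR₀f⟩ := exists_forall_of_eventually_upperHalfPlane
    (hlim.eventually_ne one_ne_zero)
  set S : Set ℂ := {z | 0 < z.im ∧ f z = 0} with hS
  -- The growth confines these zeros to a compact half disc. An accumulation point is a zero by
  -- continuity, so it is not real, and the identity theorem contradicts `f 1 ≠ 0`.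
  have hSfin : S.Finite := by
    by_contra hinf
    have hK : IsCompact (Metric.closedBall (0 : ℂ) R₀ ∩ {z | 0 ≤ z.im}) :=
      (isCompact_closedBall 0 R₀).inter_right (isClosed_le continuous_const Complex.continuous_im)
    have hSK : S ⊆ Metric.closedBall (0 : ℂ) R₀ ∩ {z | 0 ≤ z.im} := by
      rintro z ⟨hz1, hz2⟩
      refine ⟨?_, hz1.le⟩
      rw [mem_closedBall_zero_iff]
      by_contra! hlt
      exact hR₀f z hz1.le hlt.le (by rw [hz2, zero_div])
    obtain ⟨z, hzK, hacc⟩ := Set.Infinite.exists_accPt_of_subset_isCompact hinf hK hSK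
    rw [accPt_iff_frequently_nhdsNE] at hacc
    have hfz : f z = 0 := by
      by_contra hne
      have h1 : ∀ᶠ w in 𝓝[{z | 0 ≤ z.im}] z, f w ≠ 0 := (hcont z hzK.2).eventually_ne hne
      rw [eventually_nhdsWithin_iff] at h1
      refine hacc ?_
      filter_upwards [nhdsWithin_le_nhds h1] with w hw hwS
      exact hw hwS.1.le hwS.2
    have hzim : 0 < z.im := lt_of_le_of_ne hzK.2 fun h => hre0 z h.symm hfz
    have := hf.eqOn_zero_of_preconnected_of_frequently_eq_zero isPreconnected_slitPlane
      (him z hzim) (hacc.mono fun w hw => hw.2)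
    exact hf1 (this h1S)
  have hord : ∀ z ∈ Complex.slitPlane, analyticOrderAt f z ≠ ⊤ := by
    intro z hz
    refine hf.analyticOrderAt_ne_top_of_isPreconnected isPreconnected_slitPlane h1S hz ?_
    rw [(hf 1 h1S).analyticOrderAt_eq_zero.2 hf1]
    exact ENat.zero_ne_top
  set Z₁ : Finset ℂ := hSfin.toFinset with hZ₁
  have hZ₁mem : ∀ z, z ∈ Z₁ ↔ 0 < z.im ∧ f z = 0 := by intro z; simp [hZ₁, hS]
  set Z : Finset ℂ := Z₁ ∪ Z₁.image (starRingEnd ℂ) with hZ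
  have hdisj : Disjoint Z₁ (Z₁.image (starRingEnd ℂ)) := by
    rw [Finset.disjoint_left]
    intro z hz hz'
    obtain ⟨w, hw, rfl⟩ := Finset.mem_image.1 hz'
    have h1 := ((hZ₁mem _).1 hz).1
    have h2 := ((hZ₁mem _).1 hw).1
    simp at h1
    linarith
  have hinj : Set.InjOn (starRingEnd ℂ) (Z₁ : Set ℂ) := fun x _ y _ h => (starRingEnd ℂ).injective h
  have hZmem : ∀ z, z ∈ Z ↔ z ∈ Complex.slitPlane ∧ f z = 0 := by
    intro z
    rw [hZ, Finset.mem_union, Finset.mem_image]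
    constructor
    · rintro (h | ⟨w, hw, rfl⟩)
      · have := (hZ₁mem z).1 h
        exact ⟨him z this.1, this.2⟩
      · have := (hZ₁mem w).1 hw
        refine ⟨hcslit w (him w this.1), ?_⟩
        rw [hconj w (him w this.1), this.2, map_zero]
    · rintro ⟨hz, hfz⟩
      rcases lt_trichotomy z.im 0 with h | h | h
      · right
        refine ⟨starRingEnd ℂ z, (hZ₁mem _).2 ⟨by simpa using h, ?_⟩, Complex.conj_conj z⟩
        rw [hconj z hz, hfz, map_zero]
      · exact absurd hfz (hre0 z h)
      · exact Or.inl ((hZ₁mem z).2 ⟨h, hfz⟩)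
  have hZset : {z | z ∈ Complex.slitPlane ∧ f z = 0} = (Z : Set ℂ) := by
    ext z
    rw [Finset.mem_coe, hZmem]
    rfl
  set n : ℂ → ℕ := analyticOrderNatAt f with hn
  have hnconj : ∀ u ∈ Z₁, n (starRingEnd ℂ u) = n u := by
    intro u hu
    have hu' := him u ((hZ₁mem u).1 hu).1
    exact analyticOrderNatAt_conj (hf u hu') (hf _ (hcslit u hu')) (hord u hu')
      ((Complex.isOpen_slitPlane.eventually_mem hu').mono hconj)
  set k : ℕ := ∑ u ∈ Z₁, n u with hk
  have hsum : ∑ u ∈ Z, n u = 2 * k := by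
    rw [hZ, Finset.sum_union hdisj, Finset.sum_image hinj, Finset.sum_congr rfl hnconj, two_mul]
  suffices hmk : m = k by
    refine ⟨hf, ?_, ?_⟩
    · rw [hZset]; exact Z.finite_toSet
    · rw [hZset, finsum_mem_coe_finset, hsum, hmk]
  -- the quotient by the zeros
  set P : ℂ → ℂ := fun z => ∏ u ∈ Z, (z - u) ^ n u with hP
  have hPne : ∀ z ∉ Z, P z ≠ 0 := by
    intro z hz
    refine Finset.prod_ne_zero_iff.2 fun u hu => pow_ne_zero _ (sub_ne_zero.2 ?_)
    rintro rfl
    exact hz hu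
  have hrealZ : ∀ x : ℝ, (x : ℂ) ∉ Z := fun x hx => hre0 x (by simp) ((hZmem _).1 hx).2
  -- Conjugate factors multiply to `|x - u|²`, so dividing by `P` keeps real-axis values off `(-∞,
  -- 0]`.
  have hPreal : ∀ x : ℝ, ∃ t : ℝ, 0 < t ∧ P x = t := by
    intro x
    refine ⟨∏ u ∈ Z₁, Complex.normSq (x - u) ^ n u, Finset.prod_pos fun u hu => ?_, ?_⟩
    · refine pow_pos (Complex.normSq_pos.2 (sub_ne_zero.2 ?_)) _
      rintro rfl
      exact hrealZ x (Finset.mem_union_left _ hu)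
    · simp only [hP]
      rw [hZ, Finset.prod_union hdisj, Finset.prod_image hinj, ← Finset.prod_mul_distrib]
      push_cast
      refine Finset.prod_congr rfl fun u hu => ?_
      rw [hnconj u hu, ← mul_pow, Complex.normSq_eq_conj_mul_self, map_sub, Complex.conj_ofReal,
        mul_comm]
  obtain ⟨g, hg1, hg2⟩ := exists_eq_prod_mul Z (fun u hu => hf u ((hZmem u).1 hu).1)
    (fun u hu => hord u ((hZmem u).1 hu).1)
  have hgcont : ContinuousOn g {z | 0 ≤ z.im} := by
    intro z hz
    by_cases hzZ : z ∈ Z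
    · exact (hg1 z hzZ).1.continuousAt.continuousWithinAt
    · have h1 : ContinuousWithinAt (fun z => f z / P z) {z | 0 ≤ z.im} z :=
        (hcont z hz).div (Continuous.continuousWithinAt (by fun_prop)) (hPne z hzZ)
      refine h1.congr_of_eventuallyEq ?_ (hg2 z hzZ)
      have hcl : ∀ᶠ w in 𝓝 z, w ∉ Z := Z.finite_toSet.isClosed.isOpen_compl.eventually_mem hzZ
      filter_upwards [nhdsWithin_le_nhds hcl] with w hw using hg2 w hw
  have hgne : ∀ z : ℂ, 0 ≤ z.im → g z ≠ 0 := by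
    intro z hz
    by_cases hzZ : z ∈ Z
    · exact (hg1 z hzZ).2
    · rw [hg2 z hzZ]
      refine div_ne_zero (fun h0 => ?_) (hPne z hzZ)
      rcases hz.eq_or_lt with h | h
      · exact hre0 z h.symm h0
      · exact hzZ ((hZmem z).2 ⟨him z h, h0⟩)
  have hgreal : ∀ x : ℝ, g x ∈ Complex.slitPlane := by
    intro x
    obtain ⟨t, ht, hPt⟩ := hPreal x
    rw [hg2 x (hrealZ x)]
    change f x / P x ∈ _
    rw [hPt]
    have := hreal x
    rw [Complex.mem_slitPlane_iff] at this ⊢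
    rw [Complex.div_ofReal_re, Complex.div_ofReal_im]
    rcases this with h | h
    · exact Or.inl (div_pos h ht)
    · exact Or.inr (div_ne_zero h ht.ne')
  -- growth of the quotient
  have hne0 : ∀ᶠ z : ℂ in comap norm atTop ⊓ 𝓟 {z : ℂ | 0 ≤ z.im}, z ≠ 0 ∧ z ∉ Z := by
    rw [eventually_inf_principal, eventually_comap]
    filter_upwards [eventually_gt_atTop 0, eventually_gt_atTop (∑ u ∈ Z, ‖u‖)] with r hr hr' z hz _
    refine ⟨norm_pos_iff.1 (hz ▸ hr), fun hzZ => ?_⟩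
    have := Finset.single_le_sum (f := fun u : ℂ => ‖u‖) (fun u _ => norm_nonneg u) hzZ
    rw [hz] at this
    linarith
  have hPlim : Tendsto (fun z => P z / z ^ (2 * k)) (comap norm atTop ⊓ 𝓟 {z : ℂ | 0 ≤ z.im})
      (𝓝 1) := by
    have h1 : Tendsto (fun z : ℂ => ∏ u ∈ Z, ((z - u) / z) ^ n u) (comap norm atTop)
        (𝓝 (∏ u ∈ Z, 1 ^ n u)) :=
      tendsto_finsetProd _ fun u _ => (tendsto_sub_div_self u).pow (n u)
    simp only [one_pow, Finset.prod_const_one] at h1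
    refine (h1.mono_left inf_le_left).congr fun z => ?_
    simp_rw [div_pow]
    rw [Finset.prod_div_distrib, Finset.prod_pow_eq_pow_sum, hsum]
  set q : ℝ := p - 2 * k with hq
  have hglim : Tendsto (fun z => g z / z ^ (q : ℂ)) (comap norm atTop ⊓ 𝓟 {z : ℂ | 0 ≤ z.im})
      (𝓝 1) := by
    have h1 := hlim.div hPlim one_ne_zero
    rw [div_one] at h1
    refine h1.congr' ?_
    filter_upwards [hne0] with z hz
    have e : z ^ (q : ℂ) = z ^ (p : ℂ) / z ^ (2 * k) := by
      rw [hq, ← Complex.cpow_natCast, ← Complex.cpow_sub _ _ hz.1]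
      push_cast; rfl
    rw [hg2 z hz.2, e]
    change _ = f z / P z / _
    have h2 : z ^ (p : ℂ) ≠ 0 := by simp [Complex.cpow_eq_zero_iff, hz.1]
    have h3 := hPne z hz.2
    have h4 := pow_ne_zero (2 * k) hz.1
    simp only [Pi.div_apply]
    field_simp
  have hpi := Real.pi_pos
  -- The tolerance `π (1 - |p - 2m|)` gives `|q| < 2 - |p - 2m|`, exactly enough for `|2m - 2k| <
  -- 2`.
  have hev : ∀ᶠ z in comap norm atTop ⊓ 𝓟 {z : ℂ | 0 ≤ z.im},
      g z / z ^ (q : ℂ) ∈ Complex.slitPlane ∧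
        |(g z / z ^ (q : ℂ)).arg| < Real.pi * (1 - |p - 2 * m|) := by
    refine (hglim.eventually (Complex.isOpen_slitPlane.eventually_mem h1S)).and ?_
    have h1 := ((Complex.continuousAt_arg h1S).tendsto.comp hglim).abs
    rw [Complex.arg_one, abs_zero] at h1
    exact h1.eventually (gt_mem_nhds (mul_pos hpi (by linarith)))
  obtain ⟨R, hR, hRg⟩ := exists_forall_of_eventually_upperHalfPlane hev
  have key := abs_mul_pi_le_of_continuousOn_upperHalfPlane hgcont hgne hgreal (q := q) hR
    fun z hz hzR => (hRg z hz hzR.ge).1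
  have h2 := (hRg (-R : ℂ) (by simp) (by simp [abs_of_pos hR])).2
  have hq2 : |q| < 2 - |p - 2 * m| := by
    have : |q| * Real.pi < (2 - |p - 2 * m|) * Real.pi := by linarith
    exact lt_of_mul_lt_mul_right this hpi.le
  have h3 : |(2 * m - 2 * k : ℝ)| < 2 := by
    have : (2 * m - 2 * k : ℝ) = q - (p - 2 * m) := by rw [hq]; ring
    rw [this]
    have := abs_sub q (p - 2 * m)
    linarith
  have h4 := abs_lt.1 h3
  have h5 : (m : ℝ) < k + 1 := by linarith
  have h6 : (k : ℝ) < m + 1 := by linarith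
  have h5' : m < k + 1 := by exact_mod_cast h5
  have h6' : k < m + 1 := by exact_mod_cast h6
  omega

/-! ### Moments of positive exponent on the closed upper half-plane -/

theorem integral_gammaDensity_mul_pos {c a : ℝ} (hc : 0 < c) {h : ℝ → ℝ}
    (hint : IntegrableOn (fun s => gammaDensity c s * h s) (Ioi 0)) (h0 : ∀ s, 0 < s → 0 ≤ h s)
    (hpos : ∀ s, 0 < s → a < s → 0 < h s) :
    0 < ∫ s in Ioi (0 : ℝ), gammaDensity c s * h s := by
  rw [setIntegral_pos_iff_support_of_nonneg_ae ?_ hint]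
  · have hsub : Ioi (max a 0) ⊆ (Function.support fun s => gammaDensity c s * h s) ∩ Ioi 0 := by
      intro s (hs : max a 0 < s)
      have hs0 : 0 < s := (le_max_right _ _).trans_lt hs
      exact ⟨(mul_pos (gammaDensity_pos hc hs0) (hpos s hs0 ((le_max_left _ _).trans_lt hs))).ne',
        hs0⟩
    refine lt_of_lt_of_le ?_ (measure_mono hsub)
    simp
  · refine (ae_restrict_iff' measurableSet_Ioi).2 (ae_of_all _ fun s (hs : 0 < s) => ?_)
    exact mul_nonneg (gammaDensity_pos hc hs).le (h0 s hs)

theorem norm_add_cpow_le {z : ℂ} {C p s : ℝ} (hp : 0 ≤ p) (hC : 1 ≤ C) (hz : ‖z‖ ≤ C) (hs : 0 < s) :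
    ‖(z + s) ^ (p : ℂ)‖ ≤ C ^ p * 2 ^ p * (1 + s ^ p) := by
  rw [Complex.norm_cpow_real]
  have h1 : ‖z + s‖ ≤ C * (1 + s) := by
    have := norm_add_le z (s : ℂ)
    rw [Complex.norm_real, Real.norm_of_nonneg hs.le] at this
    nlinarith
  calc ‖z + s‖ ^ p ≤ (C * (1 + s)) ^ p := Real.rpow_le_rpow (norm_nonneg _) h1 hp
    _ = C ^ p * (1 + s) ^ p := Real.mul_rpow (by linarith) (by linarith)
    _ ≤ C ^ p * (2 ^ p * (1 + s ^ p)) := by gcongr; exact one_add_rpow_le hs hp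
    _ = _ := by ring

theorem norm_gammaMoment_integrand_le {z : ℂ} {c C p s : ℝ} (hc : 0 < c) (hp : 0 ≤ p) (hC : 1 ≤ C)
    (hz : ‖z‖ ≤ C) (hs : 0 < s) :
    ‖(gammaDensity c s : ℂ) * (z + s) ^ (p : ℂ)‖ ≤
      C ^ p * 2 ^ p * (gammaDensity c s * (1 + s ^ p)) := by
  have hg := gammaDensity_pos hc hs
  rw [norm_mul, Complex.norm_real, Real.norm_of_nonneg hg.le]
  calc _ ≤ gammaDensity c s * (C ^ p * 2 ^ p * (1 + s ^ p)) := by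
        gcongr; exact norm_add_cpow_le hp hC hz hs
    _ = _ := by ring

theorem integrableOn_gammaMoment_of_nonneg (z : ℂ) {p c : ℝ} (hc : 0 < c) (hp : 0 ≤ p) :
    IntegrableOn (fun s : ℝ => (gammaDensity c s : ℂ) * (z + s) ^ (p : ℂ)) (Ioi 0) := by
  refine Integrable.mono' ((integrableOn_gammaDensity_mul_one_add hc hp).const_mul
    ((‖z‖ + 1) ^ p * 2 ^ p)) (measurable_gammaMoment_integrand p c z).aestronglyMeasurable ?_
  refine (ae_restrict_iff' measurableSet_Ioi).2 (ae_of_all _ fun s (hs : 0 < s) => ?_)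
  exact norm_gammaMoment_integrand_le hc hp (by simp) (by simp) hs

/-- The principal logarithm is continuous from above on the negative axis, and `p > 0` handles the
origin. -/
theorem continuousOn_cpow_upperHalfPlane {p : ℝ} (hp : 0 < p) :
    ContinuousOn (fun w : ℂ => w ^ (p : ℂ)) {z | 0 ≤ z.im} := by
  intro w hw
  by_cases h : 0 ≤ w.re ∨ w.im ≠ 0
  · exact (Complex.continuousAt_cpow_const_of_re_pos h (by simpa)).continuousWithinAt
  · push Not at h
    have hw0 : w ≠ 0 := by
      rintro rfl
      simp at h
    have h1 := Complex.continuousWithinAt_log_of_re_neg_of_im_zero h.1 h.2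
    have h2 : ContinuousWithinAt (fun w : ℂ => Complex.exp (Complex.log w * p)) {z | 0 ≤ z.im} w :=
      (h1.mul_const _).cexp
    refine h2.congr_of_eventuallyEq ?_ (Complex.cpow_def_of_ne_zero hw0 _)
    filter_upwards [nhdsWithin_le_nhds (isOpen_ne.eventually_mem hw0)] with x hx
    exact Complex.cpow_def_of_ne_zero hx _

theorem continuousOn_gammaMoment {p c : ℝ} (hp : 0 < p) (hc : 0 < c) :
    ContinuousOn (gammaMoment p c) {z | 0 ≤ z.im} := by
  intro z hz
  have hn : ∀ᶠ w in 𝓝[{z | 0 ≤ z.im}] z, ‖w‖ ≤ ‖z‖ + 1 :=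
    nhdsWithin_le_nhds ((continuous_norm.tendsto z).eventually (Iic_mem_nhds (lt_add_one _)))
  refine tendsto_integral_filter_of_dominated_convergence
    (fun s => (‖z‖ + 1) ^ p * 2 ^ p * (gammaDensity c s * (1 + s ^ p)))
    (Eventually.of_forall fun w => (measurable_gammaMoment_integrand p c w).aestronglyMeasurable)
    ?_ ((integrableOn_gammaDensity_mul_one_add hc hp.le).const_mul _) ?_
  · filter_upwards [hn] with w hw
    refine (ae_restrict_iff' measurableSet_Ioi).2 (ae_of_all _ fun s (hs : 0 < s) => ?_)
    exact norm_gammaMoment_integrand_le hc hp.le (by simp) hw hs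
  · refine ae_of_all _ fun s => Tendsto.const_mul _ ?_
    have h1 : ContinuousOn (fun w : ℂ => (w + s) ^ (p : ℂ)) {z | 0 ≤ z.im} :=
      (continuousOn_cpow_upperHalfPlane hp).comp (f := fun w : ℂ => w + s)
        (by fun_prop) (fun w (hw : 0 ≤ w.im) => by simpa using hw)
    exact h1 z hz

/-- No branch jump: `arg z` lies in `[0, π]` and `arg (1 + s/z)` in `(-π/2, 0]`, so their sum stays
in `(-π, π]`. -/
theorem add_cpow_eq_mul {z : ℂ} (hz : 0 ≤ z.im) {s : ℝ} (hs : 0 ≤ s) (hsz : s < ‖z‖) (p : ℂ) :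
    (z + s) ^ p = z ^ p * (1 + s / z) ^ p := by
  have hz0 : z ≠ 0 := norm_pos_iff.1 (hs.trans_lt hsz)
  have hnorm : ‖(s : ℂ) / z‖ < 1 := by
    rw [norm_div, Complex.norm_real, Real.norm_of_nonneg hs, div_lt_one (norm_pos_iff.2 hz0)]
    exact hsz
  have hre : 0 < (1 + (s : ℂ) / z).re := by
    have := (Complex.abs_re_le_norm ((s : ℂ) / z)).trans_lt hnorm
    rw [Complex.add_re, Complex.one_re]
    linarith [(abs_lt.1 this).1]
  have him : (1 + (s : ℂ) / z).im ≤ 0 := by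
    rw [Complex.add_im, Complex.one_im, zero_add, Complex.div_im]
    simp only [Complex.ofReal_im, Complex.ofReal_re, zero_mul, zero_div, zero_sub]
    have : 0 ≤ s * z.im / Complex.normSq z :=
      div_nonneg (mul_nonneg hs hz) (Complex.normSq_nonneg z)
    linarith
  have h1 : (1 + (s : ℂ) / z) ≠ 0 := by
    intro h
    rw [h] at hre
    simp at hre
  have harg1 : (1 + (s : ℂ) / z).arg ≤ 0 := by
    rcases him.eq_or_lt with h | h
    · rw [Complex.arg_eq_zero_iff.2 ⟨hre.le, h⟩]
    · exact (Complex.arg_neg_iff.2 h).le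
  have harg2 := (abs_lt.1 (Complex.abs_arg_lt_pi_div_two_iff.2 (Or.inl hre))).1
  have harg3 := Complex.arg_nonneg_iff.2 hz
  have harg4 := Complex.arg_le_pi z
  have hpi := Real.pi_pos
  have hzs : z + s = z * (1 + s / z) := by field_simp
  rw [hzs, Complex.cpow_def_of_ne_zero (mul_ne_zero hz0 h1), Complex.cpow_def_of_ne_zero hz0,
    Complex.cpow_def_of_ne_zero h1, Complex.log_mul hz0 h1 ⟨by linarith, by linarith⟩, ← Complex.exp_add]
  congr 1
  ring

/-- Pointwise `(z+s)^p / z^p = (1 + s/z)^p → 1` and the density has mass one; for `|z| > 1` the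
quotient is at most `2^p (1 + s^p)` in norm. -/
theorem tendsto_gammaMoment_div_cpow {p c : ℝ} (hp : 0 < p) (hc : 0 < c) :
    Tendsto (fun z => gammaMoment p c z / z ^ (p : ℂ)) (comap norm atTop ⊓ 𝓟 {z : ℂ | 0 ≤ z.im})
      (𝓝 1) := by
  have hone : (1 : ℂ) = ∫ s in Ioi (0 : ℝ), (gammaDensity c s : ℂ) := by
    rw [integral_complex_ofReal, integral_gammaDensity hc, Complex.ofReal_one]
  have hbig : ∀ r : ℝ, ∀ᶠ z : ℂ in comap norm atTop ⊓ 𝓟 {z : ℂ | 0 ≤ z.im}, r < ‖z‖ ∧ 0 ≤ z.im := by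
    intro r
    rw [eventually_inf_principal, eventually_comap]
    filter_upwards [eventually_gt_atTop r] with t ht z hz him
    exact ⟨hz ▸ ht, him⟩
  have heq : ∀ z, gammaMoment p c z / z ^ (p : ℂ) =
      ∫ s in Ioi (0 : ℝ), (gammaDensity c s : ℂ) * (z + s) ^ (p : ℂ) / z ^ (p : ℂ) := fun z =>
    (integral_div _ _).symm
  simp_rw [heq]
  rw [hone]
  refine tendsto_integral_filter_of_dominated_convergence
    (fun s => 2 ^ p * (gammaDensity c s * (1 + s ^ p)))
    (Eventually.of_forall fun w =>
      ((measurable_gammaMoment_integrand p c w).div_const _).aestronglyMeasurable)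
    ?_ ((integrableOn_gammaDensity_mul_one_add hc hp.le).const_mul _) ?_
  · filter_upwards [hbig 1] with z hz
    refine (ae_restrict_iff' measurableSet_Ioi).2 (ae_of_all _ fun s (hs : 0 < s) => ?_)
    have hz0 : 0 < ‖z‖ := one_pos.trans hz.1
    have h1 := norm_gammaMoment_integrand_le hc hp.le hz.1.le le_rfl hs
    rw [norm_div, Complex.norm_cpow_real, div_le_iff₀ (by positivity)]
    calc _ ≤ _ := h1
      _ = _ := by ring
  · refine (ae_restrict_iff' measurableSet_Ioi).2 (ae_of_all _ fun s (hs : 0 < s) => ?_)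
    have h1 : Tendsto (fun z : ℂ => (gammaDensity c s : ℂ) * (1 + s / z) ^ (p : ℂ))
        (comap norm atTop ⊓ 𝓟 {z : ℂ | 0 ≤ z.im}) (𝓝 (gammaDensity c s : ℂ)) := by
      have h2 : Tendsto (fun z : ℂ => 1 + (s : ℂ) * z⁻¹) (comap norm atTop) (𝓝 (1 + s * 0)) := by
        rw [comap_norm_atTop]
        exact (tendsto_inv₀_cobounded.const_mul (s : ℂ)).const_add 1
      rw [mul_zero, add_zero] at h2
      have h3 := (continuousAt_cpow_const (b := (p : ℂ)) Complex.one_mem_slitPlane).tendsto.comp h2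
      rw [Complex.one_cpow] at h3
      have h4 := (h3.mono_left (inf_le_left (b := 𝓟 {z : ℂ | 0 ≤ z.im}))).const_mul
        (gammaDensity c s : ℂ)
      rw [mul_one] at h4
      exact h4
    refine h1.congr' ?_
    filter_upwards [hbig s] with z hz
    have hz0 : z ≠ 0 := norm_pos_iff.1 (hs.trans hz.1)
    have hzp : z ^ (p : ℂ) ≠ 0 := by simp [Complex.cpow_eq_zero_iff, hz0]
    rw [add_cpow_eq_mul hz.2 hs.le hz.1]
    field_simp

theorem ofReal_cpow_eq_add {p : ℝ} (hp : 0 < p) (x : ℝ) :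
    (x : ℂ) ^ (p : ℂ) = ((max (-x) 0 ^ p : ℝ) : ℂ) * Complex.exp (Real.pi * Complex.I * p) +
      ((max x 0 ^ p : ℝ) : ℂ) := by
  rcases le_total 0 x with h | h
  · rw [max_eq_right (by linarith), max_eq_left h, Real.zero_rpow hp.ne', Complex.ofReal_cpow h]
    simp
  · rw [max_eq_left (by linarith), max_eq_right h, Real.zero_rpow hp.ne',
      Complex.ofReal_cpow_of_nonpos h, Complex.ofReal_cpow (by linarith)]
    simp

theorem integrableOn_gammaDensity_mul_of_norm_le {c p C : ℝ} (hc : 0 < c) (hp : 0 ≤ p) {h : ℝ → ℝ}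
    (hm : Measurable h) (hb : ∀ s, 0 < s → |h s| ≤ C * (1 + s ^ p)) :
    IntegrableOn (fun s => gammaDensity c s * h s) (Ioi 0) := by
  refine Integrable.mono' ((integrableOn_gammaDensity_mul_one_add hc hp).const_mul C)
    ((measurable_gammaDensity c).mul hm).aestronglyMeasurable ?_
  refine (ae_restrict_iff' measurableSet_Ioi).2 (ae_of_all _ fun s (hs : 0 < s) => ?_)
  have hg := gammaDensity_pos hc hs
  rw [norm_mul, Real.norm_of_nonneg hg.le, Real.norm_eq_abs]
  calc _ ≤ gammaDensity c s * (C * (1 + s ^ p)) := by gcongr; exact hb s hs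
    _ = _ := by ring

/-- The part `s < -y` contributes `A e^(iπδ)` with `A ≥ 0` and `δ = p - 2m`, the part `s > -y` a
positive `B`. As `|δ| < 1`, the sum is real only if `A = 0` or `δ = 0`, and then it is positive. -/
theorem gammaMoment_ofReal_mem_slitPlane {p c : ℝ} (hp : 0 < p) (hc : 0 < c) {m : ℕ}
    (hpm : |p - 2 * m| < 1) (y : ℝ) : gammaMoment p c y ∈ Complex.slitPlane := by
  have hbound : ∀ σ : ℝ, |σ| = 1 → ∀ s, 0 < s → |max (σ * (y + s)) 0 ^ p| ≤
      (|y| + 1) ^ p * 2 ^ p * (1 + s ^ p) := by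
    intro σ hσ s hs
    have h1 := norm_add_cpow_le (z := (y : ℂ)) (C := |y| + 1) hp.le (by simp) (by simp) hs
    rw [Complex.norm_cpow_real, ← Complex.ofReal_add, Complex.norm_real] at h1
    rw [abs_of_nonneg (by positivity)]
    refine le_trans (Real.rpow_le_rpow (le_max_right _ _) (max_le ?_ (norm_nonneg _)) hp.le) h1
    calc σ * (y + s) ≤ |σ * (y + s)| := le_abs_self _
      _ = ‖y + s‖ := by rw [abs_mul, hσ, one_mul, Real.norm_eq_abs]
  have iA := integrableOn_gammaDensity_mul_of_norm_le hc hp.le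
    (h := fun s => max (-1 * (y + s)) 0 ^ p) (by fun_prop) (hbound (-1) (by simp))
  have iB := integrableOn_gammaDensity_mul_of_norm_le hc hp.le
    (h := fun s => max (1 * (y + s)) 0 ^ p) (by fun_prop) (hbound 1 (by simp))
  set A := ∫ s in Ioi (0 : ℝ), gammaDensity c s * max (-1 * (y + s)) 0 ^ p with hA
  set B := ∫ s in Ioi (0 : ℝ), gammaDensity c s * max (1 * (y + s)) 0 ^ p with hB
  have hA0 : 0 ≤ A := setIntegral_nonneg measurableSet_Ioi fun s (hs : 0 < s) =>
    mul_nonneg (gammaDensity_pos hc hs).le (by positivity)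
  have hB0 : 0 < B := integral_gammaDensity_mul_pos hc (a := -y) iB (fun s _ => by positivity)
    fun s _ hs => Real.rpow_pos_of_pos (lt_max_of_lt_left (by linarith)) p
  set δ := p - 2 * m with hδ
  have hexp : Complex.exp (Real.pi * Complex.I * p) = Complex.exp ((Real.pi * δ : ℝ) * Complex.I) := by
    rw [Complex.exp_eq_exp_iff_exists_int]
    refine ⟨m, ?_⟩
    rw [hδ]
    push_cast
    ring
  have key : gammaMoment p c y = A * Complex.exp ((Real.pi * δ : ℝ) * Complex.I) + B := by
    rw [hA, hB, ← integral_complex_ofReal, ← integral_complex_ofReal, ← hexp, ← integral_mul_const,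
      ← integral_add (iA.ofReal.mul_const _) iB.ofReal]
    refine setIntegral_congr_fun measurableSet_Ioi fun s (hs : 0 < s) => ?_
    rw [← Complex.ofReal_add, ofReal_cpow_eq_add hp, neg_one_mul, one_mul]
    push_cast
    ring
  have hre : (gammaMoment p c y).re = A * Real.cos (Real.pi * δ) + B := by
    rw [key, Complex.add_re, Complex.re_ofReal_mul, Complex.exp_ofReal_mul_I_re, Complex.ofReal_re]
  have him : (gammaMoment p c y).im = A * Real.sin (Real.pi * δ) := by
    rw [key, Complex.add_im, Complex.im_ofReal_mul, Complex.exp_ofReal_mul_I_im, Complex.ofReal_im,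
      add_zero]
  rw [Complex.mem_slitPlane_iff, hre, him]
  by_cases h : A * Real.sin (Real.pi * δ) = 0
  · left
    rcases mul_eq_zero.1 h with h | h
    · rw [h]; simpa using hB0
    · have hpi := Real.pi_pos
      have h1 := abs_lt.1 hpm
      have : Real.pi * δ = 0 :=
        (Real.sin_eq_zero_iff_of_lt_of_lt (by nlinarith) (by nlinarith)).1 h
      rw [this, Real.cos_zero]
      linarith
  · exact Or.inr h

/-- Generic exponents: `p` in the open interval `(2 m - 1, 2 m + 1)`. -/
theorem hasZeroCount_gammaMoment {p c : ℝ} (hp : 0 < p) (hc : 0 < c) {m : ℕ}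
    (hpm : |p - 2 * m| < 1) : HasZeroCount (gammaMoment p c) Complex.slitPlane (2 * m) :=
  hasZeroCount_of_tendsto (analyticOnNhd_gammaMoment p hc) (fun _ hz => gammaMoment_conj hz p c)
    (continuousOn_gammaMoment hp hc) (gammaMoment_ofReal_mem_slitPlane hp hc hpm) hpm
    (tendsto_gammaMoment_div_cpow hp hc)

/-! ### Odd integer exponents -/

/-- The integrand is polynomial in `z`, so the formula also holds on the cut, where the real zero
lies. -/
theorem hasDerivAt_gammaMoment_natCast {c : ℝ} (hc : 0 < c) (n : ℕ) (z : ℂ) :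
    HasDerivAt (gammaMoment ((n + 1 : ℕ) : ℝ) c) ((n + 1) * gammaMoment n c z) z := by
  have hn : (0 : ℝ) ≤ n := n.cast_nonneg
  have key := hasDerivAt_integral_of_dominated_loc_of_deriv_le
    (μ := volume.restrict (Ioi (0 : ℝ)))
    (F := fun (z : ℂ) (s : ℝ) => (gammaDensity c s : ℂ) * (z + s) ^ (((n + 1 : ℕ) : ℝ) : ℂ))
    (F' := fun (z : ℂ) (s : ℝ) => (n + 1) * ((gammaDensity c s : ℂ) * (z + s) ^ ((n : ℝ) : ℂ)))
    (bound := fun s => (n + 1) * ((‖z‖ + 1) ^ (n : ℝ) * 2 ^ (n : ℝ) *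
      (gammaDensity c s * (1 + s ^ (n : ℝ)))))
    (Metric.ball_mem_nhds z one_pos)
    (Eventually.of_forall fun w => (measurable_gammaMoment_integrand _ c w).aestronglyMeasurable)
    (integrableOn_gammaMoment_of_nonneg z hc (Nat.cast_nonneg _))
    ((measurable_gammaMoment_integrand _ c z).const_mul _).aestronglyMeasurable
    ?_ (((integrableOn_gammaDensity_mul_one_add hc hn).const_mul _).const_mul _) ?_
  · have := key.2
    rw [integral_const_mul] at this
    exact this
  · refine (ae_restrict_iff' measurableSet_Ioi).2 (ae_of_all _ fun s (hs : 0 < s) w hw => ?_)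
    have hw' : ‖w‖ ≤ ‖z‖ + 1 := by
      have h1 : ‖w - z‖ < 1 := by simpa [dist_eq_norm] using hw
      have h2 := norm_add_le z (w - z)
      rw [add_sub_cancel] at h2
      linarith
    rw [norm_mul]
    have h3 : ‖(n : ℂ) + 1‖ = n + 1 := by
      rw [← Nat.cast_succ, Complex.norm_natCast, Nat.cast_succ]
    rw [h3]
    gcongr
    exact norm_gammaMoment_integrand_le hc hn (by simp) hw' hs
  · refine ae_of_all _ fun s w _ => ?_
    simp only [Complex.ofReal_natCast, Complex.cpow_natCast]
    have h1 : HasDerivAt (fun w : ℂ => w + s) 1 w := (hasDerivAt_id w).add_const _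
    refine ((h1.pow (n + 1)).const_mul (gammaDensity c s : ℂ)).congr_deriv ?_
    simp only [Nat.add_sub_cancel]
    push_cast
    ring

theorem gammaMoment_natCast_im {c : ℝ} (n : ℕ) (x : ℝ) : (gammaMoment n c x).im = 0 := by
  have : gammaMoment n c x = ((∫ s in Ioi (0 : ℝ), gammaDensity c s * (x + s) ^ n : ℝ) : ℂ) := by
    unfold gammaMoment
    rw [← integral_complex_ofReal]
    refine setIntegral_congr_fun measurableSet_Ioi fun s _ => ?_
    simp
  rw [this, Complex.ofReal_im]

theorem gammaMoment_ofReal_re_pos {p c x : ℝ} (hc : 0 < c) (hx : 0 < x) :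
    0 < (gammaMoment p c x).re := by
  rw [gammaMoment_ofReal p c hx.le, Complex.ofReal_re]
  have hint : IntegrableOn (fun s => gammaDensity c s * (x + s) ^ p) (Ioi 0) := by
    have h := (integrableOn_gammaMoment (Complex.ofReal_mem_slitPlane.2 hx) p hc).re
    refine IntegrableOn.congr_fun h (fun s (hs : 0 < s) => ?_) measurableSet_Ioi
    simp only [RCLike.re_to_complex]
    rw [← Complex.ofReal_add, ← Complex.ofReal_cpow (by linarith), ← Complex.ofReal_mul,
      Complex.ofReal_re]
  exact integral_gammaDensity_mul_pos hc (a := 0) hint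
    (fun s hs => Real.rpow_nonneg (by linarith) p) fun s hs _ => Real.rpow_pos_of_pos (by linarith) p

theorem HasZeroCount.of_eqOn_mul {f g k : ℂ → ℂ} {S : Set ℂ} {N : ℕ} (hS : IsOpen S)
    (hg : HasZeroCount g S N) (hk : AnalyticOnNhd ℂ k S) (hk0 : ∀ z ∈ S, k z ≠ 0)
    (h : ∀ z ∈ S, f z = k z * g z) : HasZeroCount f S N := by
  obtain ⟨h1, h2, h3⟩ := hg
  have hset : {z | z ∈ S ∧ f z = 0} = {z | z ∈ S ∧ g z = 0} := by
    ext z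
    refine and_congr_right fun hz => ?_
    rw [h z hz, mul_eq_zero, or_iff_right (hk0 z hz)]
  have hev : ∀ z ∈ S, f =ᶠ[𝓝 z] k * g := fun z hz => (hS.eventually_mem hz).mono h
  refine ⟨fun z hz => ((hk z hz).mul (h1 z hz)).congr (hev z hz).symm, hset ▸ h2, ?_⟩
  rw [hset, ← h3]
  refine finsum_mem_congr rfl fun z hz => ?_
  rw [analyticOrderNatAt, analyticOrderNatAt, analyticOrderAt_congr (hev z hz.1),
    analyticOrderAt_mul (hk z hz.1) (h1 z hz.1), (hk z hz.1).analyticOrderAt_eq_zero.2 (hk0 z hz.1),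
    zero_add]

theorem hasZeroCount_zero {f : ℂ → ℂ} {S : Set ℂ} (hf : AnalyticOnNhd ℂ f S)
    (h0 : ∀ z ∈ S, f z ≠ 0) : HasZeroCount f S 0 := by
  have : {z | z ∈ S ∧ f z = 0} = ∅ := by
    ext z
    simpa using h0 z
  refine ⟨hf, ?_, ?_⟩ <;> rw [this]
  · exact finite_empty
  · exact finsum_mem_empty

/-- For odd integer exponents there is one negative zero, which lies on the cut. -/
theorem hasZeroCount_gammaMoment_odd {c : ℝ} (hc : 0 < c) {m : ℕ} (hm : 0 < m) :
    HasZeroCount (gammaMoment ((2 * m + 1 : ℕ) : ℝ) c) Complex.slitPlane (2 * m) := by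
  set p : ℝ := ((2 * m + 1 : ℕ) : ℝ) with hp
  have hp0 : 0 < p := by rw [hp]; positivity
  set F := gammaMoment p c with hF
  have hderiv : ∀ z, HasDerivAt F ((2 * m + 1 : ℂ) * gammaMoment ((2 * m : ℕ) : ℝ) c z) z := by
    intro z
    have e : (2 * m + 1 : ℂ) = ((2 * m : ℕ) : ℂ) + 1 := by push_cast; rfl
    rw [e]
    exact hasDerivAt_gammaMoment_natCast hc (2 * m) z
  have hFdiff : Differentiable ℂ F := fun z => (hderiv z).differentiableAt
  have hFim : ∀ x : ℝ, (F x).im = 0 := gammaMoment_natCast_im _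
  -- The moment of exponent `2m` is real on the axis and avoids `(-∞, 0]`, so it is positive.
  have hDpos : ∀ x : ℝ, 0 < ((2 * m + 1 : ℂ) * gammaMoment ((2 * m : ℕ) : ℝ) c x).re := by
    intro x
    have h1 := gammaMoment_ofReal_mem_slitPlane (p := ((2 * m : ℕ) : ℝ)) (by positivity) hc (m := m)
      (by simp) x
    have h2 : 0 < (gammaMoment ((2 * m : ℕ) : ℝ) c x).re :=
      (Complex.mem_slitPlane_iff.1 h1).resolve_right (not_not.2 (gammaMoment_natCast_im _ _))
    have h3 : (2 * m + 1 : ℂ) = ((2 * m + 1 : ℝ) : ℂ) := by push_cast; rfl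
    rw [h3, Complex.re_ofReal_mul]
    positivity
  have hRderiv : ∀ x : ℝ, HasDerivAt (fun x : ℝ => (F x).re) _ x := fun x =>
    (hderiv x).real_of_complex
  have hmono : StrictMono fun x : ℝ => (F x).re :=
    strictMono_of_deriv_pos fun x => by rw [(hRderiv x).deriv]; exact hDpos x
  have hcontR : Continuous fun x : ℝ => (F x).re :=
    continuous_iff_continuousAt.2 fun x => (hRderiv x).continuousAt
  have hlim := tendsto_gammaMoment_div_cpow hp0 hc
  -- the real zero
  obtain ⟨x₀, hx₀neg, hx₀⟩ : ∃ x₀ : ℝ, x₀ ≤ 0 ∧ F x₀ = 0 := by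
    have hev : ∀ᶠ z in comap norm atTop ⊓ 𝓟 {z : ℂ | 0 ≤ z.im}, 0 < (F z / z ^ (p : ℂ)).re := by
      have h1 := (Complex.continuous_re.tendsto _).comp hlim
      exact h1.eventually (lt_mem_nhds (by simp))
    obtain ⟨R, hR, hRF⟩ := exists_forall_of_eventually_upperHalfPlane hev
    have h1 := hRF ((-R : ℝ) : ℂ) (by simp) (by simp [abs_of_pos hR])
    have hneg : (F (-R : ℝ)).re < 0 := by
      have e : (((-R : ℝ) : ℂ)) ^ (p : ℂ) = ((-(R ^ (2 * m + 1)) : ℝ) : ℂ) := by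
        rw [hp, Complex.ofReal_natCast, Complex.cpow_natCast, ← Complex.ofReal_pow,
          Odd.neg_pow ⟨m, rfl⟩]
      rw [e, Complex.div_ofReal_re] at h1
      have hRp : 0 < R ^ (2 * m + 1) := by positivity
      by_contra! hge
      have := div_nonpos_of_nonneg_of_nonpos hge (neg_nonpos.2 hRp.le)
      linarith
    have hpos : 0 < (F (R : ℝ)).re := gammaMoment_ofReal_re_pos hc hR
    obtain ⟨x₀, -, hx₀⟩ := intermediate_value_Icc (by linarith : -R ≤ R) hcontR.continuousOn
      ⟨hneg.le, hpos.le⟩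
    have hx₀F : F x₀ = 0 := Complex.ext hx₀ (hFim x₀)
    refine ⟨x₀, ?_, hx₀F⟩
    by_contra! hlt
    have := gammaMoment_ofReal_re_pos (p := p) hc hlt
    rw [← hF, hx₀F] at this
    simp at this
  have hx₀slit : ∀ z ∈ Complex.slitPlane, z - x₀ ≠ 0 := by
    intro z hz h
    rw [sub_eq_zero.1 h, Complex.ofReal_mem_slitPlane] at hz
    linarith
  -- Removing the zero `x₀` lowers the growth to `z^(2m)` and makes the function positive on the
  -- whole real axis, since `F` is increasing; zeros in the cut plane are unaffected.
  set G := dslope F x₀ with hG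
  have hGdiff : Differentiable ℂ G := by
    rw [← differentiableOn_univ] at hFdiff ⊢
    exact (Complex.differentiableOn_dslope univ_mem).2 hFdiff
  have hGne : ∀ z : ℂ, z ≠ x₀ → G z = F z / (z - x₀) := by
    intro z hz
    rw [hG, dslope_of_ne _ hz, slope_def_field, hx₀, sub_zero]
  have hGcount : HasZeroCount G Complex.slitPlane (2 * m) := by
    refine hasZeroCount_of_tendsto (p := ((2 * m : ℕ) : ℝ)) (fun z _ => hGdiff.analyticAt z)
      ?_ hGdiff.continuous.continuousOn ?_ (by simp) ?_
    · intro z hz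
      have hz' : starRingEnd ℂ z - x₀ ≠ 0 := by
        have h := (starRingEnd ℂ).injective.ne (hx₀slit z hz)
        rwa [map_sub, Complex.conj_ofReal, map_zero] at h
      rw [hGne _ (sub_ne_zero.1 hz'), hGne _ (sub_ne_zero.1 (hx₀slit z hz)), map_div₀, map_sub,
        Complex.conj_ofReal, hF, gammaMoment_conj hz]
    · intro x
      left
      by_cases hx : x = x₀
      · rw [hx, hG, dslope_same, (hderiv _).deriv]
        exact hDpos x₀
      · have hxC : (x : ℂ) ≠ x₀ := by exact_mod_cast hx
        rw [hGne _ hxC, ← Complex.ofReal_sub, Complex.div_ofReal_re]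
        have h0 : (F x₀).re = 0 := by rw [hx₀]; simp
        rcases lt_or_gt_of_ne hx with h | h
        · have h1 := hmono h
          simp only [h0] at h1
          exact div_pos_of_neg_of_neg h1 (by linarith)
        · have h1 := hmono h
          simp only [h0] at h1
          exact div_pos h1 (by linarith)
    · have h1 := hlim.div ((tendsto_sub_div_self (x₀ : ℂ)).mono_left
        (inf_le_left (b := 𝓟 {z : ℂ | 0 ≤ z.im}))) one_ne_zero
      rw [div_one] at h1
      refine h1.congr' ?_
      have hev : ∀ᶠ z : ℂ in comap norm atTop ⊓ 𝓟 {z : ℂ | 0 ≤ z.im}, z ≠ 0 ∧ z ≠ x₀ := by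
        rw [eventually_inf_principal, eventually_comap]
        filter_upwards [eventually_gt_atTop 0, eventually_gt_atTop ‖(x₀ : ℂ)‖] with r hr hr' z hz _
        refine ⟨norm_pos_iff.1 (hz ▸ hr), ?_⟩
        rintro rfl
        linarith
      filter_upwards [hev] with z hz
      have hz0 := hz.1
      have hzx := sub_ne_zero.2 hz.2
      simp only [Pi.div_apply]
      rw [hGne z hz.2, hp, Complex.ofReal_natCast, Complex.ofReal_natCast, Complex.cpow_natCast,
        Complex.cpow_natCast, pow_succ]
      field_simp
      rfl
  refine hGcount.of_eqOn_mul (k := fun z => z - x₀) Complex.isOpen_slitPlane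
    (fun z _ => by fun_prop) hx₀slit fun z hz => ?_
  have := hx₀slit z hz
  rw [hGne z (sub_ne_zero.1 this)]
  field_simp

/-! ### Exponents in `[-1, 1]` and conclusion -/

/-- For exponents in `[-1, 1]` there are no zeros, since the imaginary part has a constant sign in
each half-plane. -/
theorem gammaMoment_ne_zero {p c : ℝ} (hp1 : -1 ≤ p) (hp2 : p ≤ 1) (hc : 0 < c) {z : ℂ}
    (hz : z ∈ Complex.slitPlane) : gammaMoment p c z ≠ 0 := by
  have hupper : ∀ z : ℂ, 0 < z.im → gammaMoment p c z ≠ 0 := by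
    intro z hz
    have hzs : z ∈ Complex.slitPlane := Or.inr hz.ne'
    have hint := integrableOn_gammaMoment hzs p hc
    rcases eq_or_ne p 0 with rfl | hp
    · have : gammaMoment 0 c z = 1 := by
        unfold gammaMoment
        simp only [Complex.ofReal_zero, Complex.cpow_zero, mul_one]
        rw [integral_complex_ofReal, integral_gammaDensity hc, Complex.ofReal_one]
      rw [this]
      exact one_ne_zero
    · have hre : ∀ s : ℝ, p * ((gammaDensity c s : ℂ) * (z + s) ^ (p : ℂ)).im =
          gammaDensity c s * (p * ((z + s) ^ (p : ℂ)).im) := by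
        intro s
        rw [Complex.im_ofReal_mul]
        ring
      -- Since `0 < arg w < π` and `|p| ≤ 1`, the angle `p arg w` lies in `(-π, π)` and its sine has
      -- the sign of `p`.
      have hsign : ∀ s : ℝ, 0 < s → 0 < p * ((z + s) ^ (p : ℂ)).im := by
        intro s hs
        set w : ℂ := z + s with hw
        have hwim : 0 < w.im := by simpa [hw] using hz
        have hw0 : w ≠ 0 := by
          rintro h
          rw [h] at hwim
          simp at hwim
        have hpi := Real.pi_pos
        have ha0 : 0 < w.arg := by
          refine lt_of_le_of_ne (Complex.arg_nonneg_iff.2 hwim.le) fun h => ?_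
          exact hwim.ne' (Complex.arg_eq_zero_iff.1 h.symm).2
        have ha1 : w.arg < Real.pi := Complex.arg_lt_pi_iff.2 (Or.inr hwim.ne')
        have him : (w ^ (p : ℂ)).im = ‖w‖ ^ p * Real.sin (w.arg * p) := by
          rw [Complex.cpow_ofReal, Complex.im_ofReal_mul, Complex.add_im, Complex.mul_I_im,
            Complex.ofReal_im, Complex.ofReal_re, zero_add]
        rw [him]
        have hnorm : 0 < ‖w‖ ^ p := Real.rpow_pos_of_pos (norm_pos_iff.2 hw0) p
        rcases lt_or_gt_of_ne hp with h | h
        · have : Real.sin (w.arg * p) < 0 :=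
            Real.sin_neg_of_neg_of_neg_pi_lt (by nlinarith) (by nlinarith)
          exact mul_pos_of_neg_of_neg h (mul_neg_of_pos_of_neg hnorm this)
        · have : 0 < Real.sin (w.arg * p) :=
            Real.sin_pos_of_pos_of_lt_pi (by positivity) (by nlinarith)
          positivity
      have hint' : IntegrableOn (fun s => gammaDensity c s * (p * ((z + s) ^ (p : ℂ)).im))
          (Ioi 0) := by
        refine (hint.im.const_mul p).congr (ae_of_all _ fun s => ?_)
        exact hre s
      have hpos := integral_gammaDensity_mul_pos hc (a := 0) hint' (fun s hs => (hsign s hs).le)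
        fun s hs _ => hsign s hs
      have heq : p * (gammaMoment p c z).im =
          ∫ s in Ioi (0 : ℝ), gammaDensity c s * (p * ((z + s) ^ (p : ℂ)).im) := by
        have h1 := integral_im hint
        simp only [RCLike.im_to_complex] at h1
        unfold gammaMoment
        rw [← h1, ← integral_const_mul]
        simp_rw [hre]
      intro h0
      rw [← heq, h0] at hpos
      simp at hpos
  rcases lt_trichotomy z.im 0 with h | h | h
  · intro h0
    refine hupper (starRingEnd ℂ z) (by simpa using h) ?_
    rw [gammaMoment_conj hz, h0, map_zero]
  · have hre : 0 < z.re := (Complex.mem_slitPlane_iff.1 hz).resolve_right (not_not.2 h)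
    have hzr : ((z.re : ℝ) : ℂ) = z := Complex.ext rfl (by simp [h])
    have := gammaMoment_ofReal_re_pos (p := p) hc hre
    rw [hzr] at this
    intro h0
    rw [h0] at this
    simp at this
  · exact hupper z h

theorem hasZeroCount_tricomiU_of_lt_one {a b : ℝ} {N : ℕ} (hb : b < 1) (hc : 0 < a - b + 1)
    (h : HasZeroCount (gammaMoment (-a) (a - b + 1)) Complex.slitPlane N) :
    HasZeroCount (tricomiU a b) Complex.slitPlane N :=
  h.of_eqOn_mul (k := fun _ => 1) Complex.isOpen_slitPlane analyticOnNhd_const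
    (fun _ _ => one_ne_zero) fun z hz => by rw [tricomiU_eq_gammaMoment hb hc hz, one_mul]

theorem hasZeroCount_tricomiU_of_one_le {a b : ℝ} (hb : 1 ≤ b) (ha : 0 < a) (hc : 0 ≤ a - b + 1)
    (hc1 : a - b + 1 ≤ 1) : HasZeroCount (tricomiU a b) Complex.slitPlane 0 := by
  refine (hasZeroCount_zero (analyticOnNhd_gammaMoment (-(a - b + 1)) ha) fun z hz =>
    gammaMoment_ne_zero (by linarith) (by linarith) ha hz).of_eqOn_mul
    (k := fun z => z ^ ((1 - b : ℝ) : ℂ)) Complex.isOpen_slitPlane ?_ ?_ fun z hz =>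
    tricomiU_eq_cpow_mul_gammaMoment hb ha hz
  · exact fun z hz => analyticAt_id.cpow analyticAt_const hz
  · intro z hz
    simp [Complex.cpow_eq_zero_iff, Complex.slitPlane_ne_zero hz]

theorem mainTheorem3 :
    (∀ (m : ℕ) (a b : ℝ), -2 * (m : ℝ) - 1 ≤ a → a < -2 * (m : ℝ) + 1 → b < a + 1 →
      HasZeroCount (tricomiU a b) Complex.slitPlane (2 * m)) ∧
    (∀ a b : ℝ, a = b → 1 ≤ b →
      HasZeroCount (tricomiU a b) Complex.slitPlane 0) := by
  refine ⟨fun m a b h1 h2 h3 => ?_, fun a b hab hb => ?_⟩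
  · have hc : 0 < a - b + 1 := by linarith
    rcases Nat.eq_zero_or_pos m with rfl | hm
    · simp only [Nat.cast_zero, mul_zero, zero_sub, zero_add] at h1 h2
      rw [mul_zero]
      rcases lt_or_ge b 1 with hb | hb
      · exact hasZeroCount_tricomiU_of_lt_one hb hc
          (hasZeroCount_zero (analyticOnNhd_gammaMoment _ hc) fun z hz =>
            gammaMoment_ne_zero (by linarith) (by linarith) hc hz)
      -- Here `1 ≤ b < a + 1` forces `a > 0`, and `a - b + 1 ≤ a < 1`.
      · exact hasZeroCount_tricomiU_of_one_le hb (by linarith) hc.le (by linarith)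
    · have hm1 : (1 : ℝ) ≤ m := by exact_mod_cast hm
      -- For `m ≥ 1`, `b < a + 1 < 2 - 2m ≤ 0`, so the plain moment applies.
      refine hasZeroCount_tricomiU_of_lt_one (by linarith) hc ?_
      rcases h1.eq_or_lt with h | h
      · have e : -a = ((2 * m + 1 : ℕ) : ℝ) := by
          rw [← h]
          push_cast
          ring
        rw [e]
        exact hasZeroCount_gammaMoment_odd hc hm
      · exact hasZeroCount_gammaMoment (by linarith) hc (abs_lt.2 ⟨by linarith, by linarith⟩)
  · subst hab
    exact hasZeroCount_tricomiU_of_one_le hb (by linarith) (by linarith) (by linarith)
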